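/- Let $-1<q<1$, let $H_0$ be a real Hilbert space with complexification $H$, and let $\mathcal F_q(H)$ be the $q$-Fock space, that is, the Hilbert space completion of $\mathbb C\Omega\oplus H\oplus H^{\otimes 2}\oplus\cdots$ (algebraic tensor powers) for the form $$\langle f_1\otimes\cdots\otimes f_m,\,g_1\otimes\cdots\otimes g_n\rangle_q=\delta_{mn}\sum_{\pi\in S_n}q^{\iota(\pi)}\prod_{i=1}^n\langle f_i,g_{\pi(i)}\rangle ,$$ where $\iota(\pi)$ is the number of inversions of $\pi$. For $f\in H_0$ let $a^+(f),a^-(f)$ be the bounded operators on $\mathcal F_q(H)$ with $a^+(f)(f_1\otimes\cdots\otimes f_n)=f\otimes f_1\otimes\cdots\otimes f_n$ and $a^-(f)(f_1\otimes\cdots\otimes f_n)=\sum_i q^{i-1}\langle f,f_i\rangle f_1\otimes\cdots\widehat{f_i}\cdots\otimes f_n$ (so $a^+(f)\Omega=f$, $a^-(f)\Omega=0$), let $\varphi(f)=a^+(f)+a^-(f)$, and let $\mathbb E(T)=\langle T\Omega,\Omega\rangle$. For $\xi_i=\varphi(f_i)$ with $f_i\in H_0$, the $q$-Wick product is $$:\!\xi_1\cdots\xi_n\!:\;=\sum_{I\sqcup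 J=\{1,\dots,n\}}q^{\iota(I,J)}\,a^+(f_{i_1})\cdots a^+(f_{i_k})\,a^-(f_{j_1})\cdots a^-(f_{j_l}),$$ where $I=\{i_1<\cdots<i_k\}$, $J=\{j_1<\cdots<j_l\}$ and $\iota(I,J)=\#\{(i,j)\in I\times J: i>j\}$. A Feynman diagram $\gamma$ on a finite linearly ordered set $S$ is a partition of $S$ into sets of one or two elements, identified with the set of ordered pairs $(i,j)$, $i<j$, such that $\{i,j\}$ is a member of the partition; the elements of $S$ in no pair are the singletons. Let $c(\gamma)$ be the number of crossings, i.e. of pairs $(k,l),(i,j)\in\gamma$ with $k<i<l<j$, let $d(\gamma)$ be the number of degenerate crossings, i.e. of triples $i<k<j$ with $(i,j)\in\gamma$ and $k$ a singleton, and let $tc(\gamma)=c(\gamma)+d(\gamma)$ be the total crossing number. For $q$-Gaussians $\xi_s=\varphi(f_s)$, $s\in S$, put $$:\!v(\gamma)\!:\;=\Big(\prod_{(i,j)\in\gamma}\mathbb E(\xi_i\xi_j)\Big):\!\xi_{h_1}\cdots\xi_{h_r}\!:,$$ where $h_1<\cdots<h_r$ are the singletons of $\gamma$ (and $:\!v(\gamma)\!:=\prod\mathbb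 E(\xi_i\xi_j)\,I$ if there are none). Theorem. Let $\xi_{p,k}=\varphi(f_{p,k})$, $f_{p,k}\in H_0$, $1\le p\le t$, $1\le k\le n_p$, be $q$-Gaussians, and let $Y_p=\;:\!\xi_{p,1}\cdots\xi_{p,n_p}\!:$. Let $S_{\rm lex}$ be the set of all indices $(p,k)$ with the lexicographic order. Then, as bounded operators on $\mathcal F_q(H)$, $$Y_1\cdots Y_t=\sum_\gamma q^{tc(\gamma)}:\!v(\gamma)\!:,$$ where the sum is over all Feynman diagrams $\gamma$ on $S_{\rm lex}$ containing no pair $((p,k),(p,l))$, that is, not linking two vertices with the same first index. Here $q^0=1$ also for $q=0$. -/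

import Mathlib

noncomputable section

open scoped TensorProduct InnerProductSpace ComplexConjugate ComplexOrder

namespace QFock

/-! ### Complexification of a real Hilbert space -/

/-- The complexification `V ⊕ iV` of a real vector space; `⟨x, y⟩` stands for `x + iy`. -/
@[ext]
structure Complexification (V : Type*) where
  re : V
  im : V

namespace Complexification

variable {V : Type*} [NormedAddCommGroup V]

/-- The underlying pair. -/
def equivProd (V : Type*) : Complexification V ≃ V × V where
  toFun v := (v.re, v.im)
  invFun p := ⟨p.1, p.2⟩
  left_inv _ := rfl
  right_inv _ := rfl

instance : AddCommGroup (Complexification V) := (equivProd V).addCommGroup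

theorem re_zero : (0 : Complexification V).re = 0 := rfl

theorem im_zero : (0 : Complexification V).im = 0 := rfl

theorem re_add (v w : Complexification V) : (v + w).re = v.re + w.re := rfl

theorem im_add (v w : Complexification V) : (v + w).im = v.im + w.im := rfl

variable [InnerProductSpace ℝ V]

instance : SMul ℂ (Complexification V) :=
  ⟨fun z v => ⟨z.re • v.re - z.im • v.im, z.re • v.im + z.im • v.re⟩⟩

theorem re_smul (z : ℂ) (v : Complexification V) : (z • v).re = z.re • v.re - z.im • v.im := rfl

theorem im_smul (z : ℂ) (v : Complexification V) : (z • v).im = z.re • v.im + z.im • v.re := rfl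

instance : Module ℂ (Complexification V) where
  one_smul v := by
    ext <;> simp [re_smul, im_smul]
  mul_smul z w v := by
    ext <;> simp only [re_smul, im_smul, Complex.mul_re, Complex.mul_im] <;> module
  smul_zero z := by
    ext <;> simp [re_smul, im_smul, re_zero, im_zero]
  smul_add z v w := by
    ext <;> simp only [re_smul, im_smul, re_add, im_add] <;> module
  add_smul z w v := by
    ext <;> simp only [re_smul, im_smul, re_add, im_add, Complex.add_re, Complex.add_im] <;> module
  zero_smul v := by
    ext <;> simp [re_smul, im_smul, re_zero, im_zero]

/-- `⟪x + iy, x' + iy'⟫ = ⟪x, x'⟫ + ⟪y, y'⟫ + i (⟪x, y'⟫ - ⟪y, x'⟫)`, which is linear in the second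
variable and conjugate linear in the first. -/
@[reducible]
def core : InnerProductSpace.Core ℂ (Complexification V) where
  inner v w := ⟨⟪v.re, w.re⟫_ℝ + ⟪v.im, w.im⟫_ℝ, ⟪v.re, w.im⟫_ℝ - ⟪v.im, w.re⟫_ℝ⟩
  conj_inner_symm v w := by
    apply Complex.ext <;> simp [real_inner_comm]
  re_inner_nonneg v := add_nonneg real_inner_self_nonneg real_inner_self_nonneg
  add_left u v w := by
    apply Complex.ext <;> simp only [re_add, im_add, inner_add_left, Complex.add_re,
      Complex.add_im] <;> ring
  smul_left v w z := by
    apply Complex.ext <;> simp only [re_smul, im_smul, inner_add_left, inner_sub_left,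
      real_inner_smul_left, Complex.mul_re, Complex.mul_im, Complex.conj_re, Complex.conj_im] <;>
      ring
  definite v h := by
    have h1 : ⟪v.re, v.re⟫_ℝ + ⟪v.im, v.im⟫_ℝ = 0 := congrArg Complex.re h
    have h2 : 0 ≤ ⟪v.re, v.re⟫_ℝ := real_inner_self_nonneg
    have h3 : 0 ≤ ⟪v.im, v.im⟫_ℝ := real_inner_self_nonneg
    ext
    · exact inner_self_eq_zero (𝕜 := ℝ).1 (by linarith)
    · exact inner_self_eq_zero (𝕜 := ℝ).1 (by linarith)

instance : NormedAddCommGroup (Complexification V) :=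
  core.toNormedAddCommGroup

instance : InnerProductSpace ℂ (Complexification V) :=
  InnerProductSpace.ofCore core.toCore

/-- The inclusion of `V` in its complexification. -/
def ofReal (x : V) : Complexification V := ⟨x, 0⟩

theorem inner_ofReal (x y : V) : ⟪ofReal x, ofReal y⟫_ℂ = (⟪x, y⟫_ℝ : ℂ) := by
  change (⟨⟪x, y⟫_ℝ + ⟪(0 : V), (0 : V)⟫_ℝ, ⟪x, (0 : V)⟫_ℝ - ⟪(0 : V), y⟫_ℝ⟩ : ℂ) = _
  apply Complex.ext <;> simp

end Complexification

/-! ### The hermitian form on tensor powers -/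

/-- The number of inversions of a permutation. -/
def inversions {n : ℕ} (π : Equiv.Perm (Fin n)) : ℕ :=
  (Finset.univ.filter fun p : Fin n × Fin n => p.1 < p.2 ∧ π p.2 < π p.1).card

variable {E : Type*} [NormedAddCommGroup E] [InnerProductSpace ℂ E]

/-- The linear functional `g ↦ ⟨f, g⟩_q` on `E^{⊗n}`, for an elementary tensor `f`. -/
def elemFunctional (q : ℝ) {n : ℕ} (f : Fin n → E) : (⨂[ℂ]^n E) →ₗ[ℂ] ℂ :=
  PiTensorProduct.lift (∑ π : Equiv.Perm (Fin n), ((q : ℂ) ^ inversions π) •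
    (MultilinearMap.mkPiAlgebra ℂ (Fin n) ℂ).compLinearMap
      (fun j => (innerSL ℂ (f (π.symm j))).toLinearMap))

theorem elemFunctional_tprod (q : ℝ) {n : ℕ} (f g : Fin n → E) :
    elemFunctional q f (PiTensorProduct.tprod ℂ g) =
      ∑ π : Equiv.Perm (Fin n), (q : ℂ) ^ inversions π * ∏ i, ⟪f i, g (π i)⟫_ℂ := by
  simp only [elemFunctional, PiTensorProduct.lift.tprod, sum_apply,
    smul_apply, MultilinearMap.compLinearMap_apply, MultilinearMap.mkPiAlgebra_apply,
    smul_eq_mul]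
  refine Finset.sum_congr rfl fun π _ => ?_
  congr 1
  rw [← Equiv.prod_comp π]
  simp

theorem conjLM_ext {n : ℕ} {A B : (⨂[ℂ]^n E) →ₗ⋆[ℂ] ℂ}
    (h : ∀ g, A (PiTensorProduct.tprod ℂ g) = B (PiTensorProduct.tprod ℂ g)) : A = B := by
  ext x
  induction x using PiTensorProduct.induction_on with
  | smul_tprod r g => simp [h]
  | add x y hx hy => simp [hx, hy]

/-- `(x, y) ↦ conj ⟨x, y⟩_q` on `E^{⊗n}`, linear in `x` and conjugate linear in `y`. -/
def conjForm (q : ℝ) (n : ℕ) : (⨂[ℂ]^n E) →ₗ[ℂ] ((⨂[ℂ]^n E) →ₗ⋆[ℂ] ℂ) :=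
  PiTensorProduct.lift
    { toFun := fun f =>
        { toFun := fun y => conj (elemFunctional q f y)
          map_add' := by simp
          map_smul' := by simp }
      map_update_add' := by
        intro hd f i x y
        apply conjLM_ext
        intro g
        obtain rfl : hd = instDecidableEqFin n := Subsingleton.elim _ _
        simp only [LinearMap.coe_mk, AddHom.coe_mk, LinearMap.add_apply, elemFunctional_tprod,
          ← map_add, ← Finset.sum_add_distrib, ← mul_add]
        congr 1
        refine Finset.sum_congr rfl fun π _ => ?_
        congr 1
        rw [← Finset.mul_prod_erase _ _ (Finset.mem_univ i),
          ← Finset.mul_prod_erase _ _ (Finset.mem_univ i),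
          ← Finset.mul_prod_erase _ _ (Finset.mem_univ i)]
        simp only [Function.update_self, inner_add_left, add_mul]
        congr 2 <;>
        · refine Finset.prod_congr rfl fun j hj => ?_
          simp [Function.update_of_ne (Finset.ne_of_mem_erase hj)]
      map_update_smul' := by
        intro hd f i c x
        apply conjLM_ext
        intro g
        obtain rfl : hd = instDecidableEqFin n := Subsingleton.elim _ _
        simp only [LinearMap.coe_mk, AddHom.coe_mk, LinearMap.smul_apply, elemFunctional_tprod,
          smul_eq_mul]
        rw [← Complex.conj_conj c, ← map_mul, Complex.conj_conj, Finset.mul_sum]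
        congr 1
        refine Finset.sum_congr rfl fun π _ => ?_
        rw [mul_left_comm]
        congr 1
        rw [← Finset.mul_prod_erase _ _ (Finset.mem_univ i),
          ← Finset.mul_prod_erase _ _ (Finset.mem_univ i)]
        simp only [Function.update_self, inner_smul_left, mul_assoc]
        congr 2
        refine Finset.prod_congr rfl fun j hj => ?_
        simp [Function.update_of_ne (Finset.ne_of_mem_erase hj)] }

/-- The hermitian form `⟨x, y⟩_q` on `E^{⊗n}`. -/
def tensorForm (q : ℝ) (n : ℕ) (x y : ⨂[ℂ]^n E) : ℂ := conj (conjForm q n x y)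

theorem tensorForm_tprod (q : ℝ) {n : ℕ} (f g : Fin n → E) :
    tensorForm q n (PiTensorProduct.tprod ℂ f) (PiTensorProduct.tprod ℂ g) =
      ∑ π : Equiv.Perm (Fin n), (∏ i, ⟪f i, g (π i)⟫_ℂ) * (q : ℂ) ^ inversions π := by
  simp only [tensorForm, conjForm, PiTensorProduct.lift.tprod, MultilinearMap.coe_mk,
    LinearMap.coe_mk, AddHom.coe_mk, Complex.conj_conj, elemFunctional_tprod]
  exact Finset.sum_congr rfl fun π _ => mul_comm _ _

theorem inversions_inv {n : ℕ} (π : Equiv.Perm (Fin n)) : inversions π⁻¹ = inversions π := by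
  unfold inversions
  refine Finset.card_bij' (fun p _ => (π⁻¹ p.2, π⁻¹ p.1)) (fun p _ => (π p.2, π p.1)) ?_ ?_ ?_ ?_ <;>
    simp +contextual

theorem tensorForm_symm (q : ℝ) (n : ℕ) (x y : ⨂[ℂ]^n E) :
    conj (tensorForm q n y x) = tensorForm q n x y := by
  induction x using PiTensorProduct.induction_on with
  | add x x' hx hx' => simp_all [tensorForm]
  | smul_tprod r f =>
    induction y using PiTensorProduct.induction_on with
    | add y y' hy hy' =>
      simp only [tensorForm, map_add, LinearMap.add_apply] at hy hy' ⊢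
      rw [hy, hy']
    | smul_tprod s g =>
      have h : conj (tensorForm q n (PiTensorProduct.tprod ℂ g) (PiTensorProduct.tprod ℂ f)) =
          tensorForm q n (PiTensorProduct.tprod ℂ f) (PiTensorProduct.tprod ℂ g) := by
        rw [tensorForm_tprod, tensorForm_tprod, map_sum, ← Equiv.sum_comp (Equiv.inv _)]
        refine Finset.sum_congr rfl fun π _ => ?_
        simp only [Equiv.inv_apply, inversions_inv, map_mul, map_pow, Complex.conj_ofReal, map_prod,
          inner_conj_symm]
        congr 1
        change ∏ i, ⟪f (π⁻¹ i), g i⟫_ℂ = _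
        refine (Equiv.prod_comp π _).symm.trans (Finset.prod_congr rfl fun i _ => ?_)
        exact congrArg (fun j => ⟪f j, g (π i)⟫_ℂ) (Equiv.symm_apply_apply π i)
      simp only [tensorForm, map_smul, LinearMap.smul_apply, LinearMap.map_smulₛₗ, smul_eq_mul,
        map_mul, Complex.conj_conj] at h ⊢
      rw [h]
      ring

/-! ### Positivity of the form -/

theorem posSemidef_prod {ι κ : Type*} [Finite ι] (s : Finset κ) (A : κ → Matrix ι ι ℂ)
    (hA : ∀ e, (A e).PosSemidef) :
    (Matrix.of fun i j => ∏ e ∈ s, A e i j).PosSemidef := by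
  classical
  induction s using Finset.induction_on with
  | empty =>
    have h : (Matrix.of fun i j => ∏ e ∈ (∅ : Finset κ), A e i j) =
        Matrix.gram ℂ (fun _ : ι => (1 : ℂ)) := by
      ext i j
      simp [Matrix.gram]
    rw [h]
    exact Matrix.posSemidef_gram ℂ (fun _ : ι => (1 : ℂ))
  | insert e s he ih =>
    have h : (Matrix.of fun i j => ∏ e ∈ insert e s, A e i j) =
        (A e).hadamard (Matrix.of fun i j => ∏ e ∈ s, A e i j) := by
      ext i j
      simp [Finset.prod_insert he, Matrix.hadamard]
    rw [h]
    exact (hA e).hadamard ih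

theorem posSemidef_ite {ι : Type*} [Finite ι] (p : ι → Prop) [DecidablePred p] (q : ℝ)
    (hq : |q| ≤ 1) :
    (Matrix.of fun i j : ι => if (p i ↔ p j) then (1 : ℂ) else q).PosSemidef := by
  have h1 := Matrix.posSemidef_gram ℂ (fun i : ι => if p i then (1 : ℂ) else q)
  have h2 := Matrix.posSemidef_gram ℂ (fun i : ι => if p i then (0 : ℂ) else (√(1 - q ^ 2) : ℝ))
  have h : (Matrix.of fun i j : ι => if (p i ↔ p j) then (1 : ℂ) else q) =
      Matrix.gram ℂ (fun i : ι => if p i then (1 : ℂ) else q) +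
      Matrix.gram ℂ (fun i : ι => if p i then (0 : ℂ) else (√(1 - q ^ 2) : ℝ)) := by
    ext i j
    have h3 : (√(1 - q ^ 2) : ℂ) * (√(1 - q ^ 2) : ℂ) = 1 - q ^ 2 := by
      rw [← Complex.ofReal_mul, Real.mul_self_sqrt]
      · push_cast; rfl
      · have := (sq_le_one_iff_abs_le_one q).2 hq
        linarith
    by_cases hi : p i <;> by_cases hj : p j <;>
      simp [Matrix.gram, hi, hj, h3]
    ring
  rw [h]
  exact h1.add h2

theorem pow_inversions {n : ℕ} (q : ℂ) (σ τ : Equiv.Perm (Fin n)) :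
    q ^ inversions (τ * σ⁻¹) =
      ∏ p ∈ Finset.univ.filter (fun p : Fin n × Fin n => p.1 < p.2),
        if (σ p.1 < σ p.2 ↔ τ p.1 < τ p.2) then 1 else q := by
  let F : Fin n × Fin n → ℂ := fun p => if σ p.1 < σ p.2 ∧ τ p.2 < τ p.1 then q else 1
  have h1 : q ^ inversions (τ * σ⁻¹) = ∏ p, F p := by
    rw [inversions, ← Finset.prod_const, Finset.prod_filter,
      ← Equiv.prod_comp (Equiv.prodCongr σ σ)]
    refine Finset.prod_congr rfl fun p _ => ?_
    simp [F]
  have h2 : ∏ p, F p = (∏ p, if p.1 < p.2 then F p else 1) *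
      ∏ p, if p.2 < p.1 then F p else 1 := by
    rw [← Finset.prod_mul_distrib]
    refine Finset.prod_congr rfl fun p _ => ?_
    rcases lt_trichotomy p.1 p.2 with h | h | h
    · simp [h, h.not_gt]
    · simp [F, h]
    · simp [h, h.not_gt]
  have h3 : (∏ p : Fin n × Fin n, if p.2 < p.1 then F p else 1) =
      ∏ p : Fin n × Fin n, if p.1 < p.2 then F p.swap else 1 := by
    rw [← Equiv.prod_comp (Equiv.prodComm _ _)]
    rfl
  rw [h1, h2, h3, ← Finset.prod_mul_distrib, Finset.prod_filter]
  refine Finset.prod_congr rfl fun p _ => ?_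
  split_ifs with h4 h5
  · have hs : ¬ (σ p.1 < σ p.2 ∧ τ p.2 < τ p.1) := fun h => (h5.1 h.1).not_gt h.2
    have hs' : ¬ (σ p.2 < σ p.1 ∧ τ p.1 < τ p.2) := fun h => (h5.2 h.2).not_gt h.1
    simp [F, hs, hs']
  · have hσ : σ p.1 ≠ σ p.2 := fun h => h4.ne (σ.injective h)
    have hτ : τ p.1 ≠ τ p.2 := fun h => h4.ne (τ.injective h)
    by_cases h6 : σ p.1 < σ p.2
    · have h7 : τ p.2 < τ p.1 := lt_of_le_of_ne (not_lt.1 fun h => h5 ⟨fun _ => h, fun _ => h6⟩) hτ.symm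
      simp [F, h6, h7, h6.not_gt]
    · have h8 : τ p.1 < τ p.2 := by
        by_contra h
        exact h5 ⟨fun h' => absurd h' h6, fun h' => absurd h' h⟩
      have h7 : σ p.2 < σ p.1 := lt_of_le_of_ne (not_lt.1 h6) hσ.symm
      simp [F, h6, h7, h8]
  · simp

theorem tensorForm_nonneg (q : ℝ) (hq : |q| ≤ 1) (n : ℕ) (x : ⨂[ℂ]^n E) :
    0 ≤ tensorForm q n x x := by
  classical
  have hx : x ∈ Submodule.span ℂ (Set.range (PiTensorProduct.tprod ℂ (s := fun _ : Fin n => E))) := by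
    rw [PiTensorProduct.span_tprod_eq_top]; trivial
  obtain ⟨c, rfl⟩ := Finsupp.mem_span_range_iff_exists_finsupp.1 hx
  let M : Matrix (c.support × Equiv.Perm (Fin n)) (c.support × Equiv.Perm (Fin n)) ℂ :=
    Matrix.of fun a b => (q : ℂ) ^ inversions (b.2 * a.2⁻¹) *
      ∏ i, ⟪(a.1 : Fin n → E) (a.2 i), (b.1 : Fin n → E) (b.2 i)⟫_ℂ
  have hM : M.PosSemidef := by
    have h1 := posSemidef_prod (Finset.univ.filter (fun p : Fin n × Fin n => p.1 < p.2))
      (fun p => Matrix.of fun a b : c.support × Equiv.Perm (Fin n) =>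
        if (a.2 p.1 < a.2 p.2 ↔ b.2 p.1 < b.2 p.2) then (1 : ℂ) else q)
      (fun p => posSemidef_ite (fun a : c.support × Equiv.Perm (Fin n) => a.2 p.1 < a.2 p.2) q hq)
    have h2 := posSemidef_prod (Finset.univ : Finset (Fin n))
      (fun i => Matrix.gram ℂ (fun a : c.support × Equiv.Perm (Fin n) =>
        (a.1 : Fin n → E) (a.2 i))) (fun i => Matrix.posSemidef_gram ℂ _)
    have h : M = (Matrix.of fun a b => ∏ e ∈ Finset.univ.filter
        (fun p : Fin n × Fin n => p.1 < p.2), Matrix.of (fun a b : c.support × Equiv.Perm (Fin n) =>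
          if (a.2 e.1 < a.2 e.2 ↔ b.2 e.1 < b.2 e.2) then (1 : ℂ) else q) a b).hadamard
        (Matrix.of fun a b => ∏ i, Matrix.gram ℂ (fun a : c.support × Equiv.Perm (Fin n) =>
          (a.1 : Fin n → E) (a.2 i)) a b) := by
      ext a b
      simp only [M, Matrix.hadamard_apply, Matrix.of_apply, pow_inversions, Matrix.gram]
    rw [h]
    exact h1.hadamard h2
  have h := hM.dotProduct_mulVec_nonneg (fun a => c a.1)
  have key : (Fintype.card (Equiv.Perm (Fin n)) : ℂ) * tensorForm q n
      (c.sum fun i a => a • (PiTensorProduct.tprod ℂ) i)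
      (c.sum fun i a => a • (PiTensorProduct.tprod ℂ) i) =
      star (fun a : c.support × Equiv.Perm (Fin n) => c a.1) ⬝ᵥ M.mulVec (fun a => c a.1) := by
    have h3 : tensorForm q n (c.sum fun i a => a • (PiTensorProduct.tprod ℂ) i)
      (c.sum fun i a => a • (PiTensorProduct.tprod ℂ) i) =
        ∑ v : c.support, ∑ w : c.support, conj (c v) * c w * ∑ π : Equiv.Perm (Fin n),
          (∏ i, ⟪(v : Fin n → E) i, (w : Fin n → E) (π i)⟫_ℂ) * (q : ℂ) ^ inversions π := by
      simp only [← tensorForm_tprod]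
      rw [Finsupp.sum, ← Finset.sum_coe_sort]
      simp only [tensorForm, map_sum, LinearMap.sum_apply, map_smul, LinearMap.smul_apply,
        LinearMap.map_smulₛₗ, smul_eq_mul, map_mul, Complex.conj_conj, Finset.mul_sum]
      rw [Finset.sum_comm]
      exact Finset.sum_congr rfl fun v _ => Finset.sum_congr rfl fun w _ => by ring
    have h4 : ∀ (v w : Fin n → E) (σ : Equiv.Perm (Fin n)),
        ∑ π : Equiv.Perm (Fin n), (∏ i, ⟪v i, w (π i)⟫_ℂ) * (q : ℂ) ^ inversions π =
        ∑ τ : Equiv.Perm (Fin n), (q : ℂ) ^ inversions (τ * σ⁻¹) *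
          ∏ i, ⟪v (σ i), w (τ i)⟫_ℂ := by
      intro v w σ
      rw [← Equiv.sum_comp (Equiv.mulRight σ⁻¹)]
      refine Finset.sum_congr rfl fun τ _ => ?_
      rw [mul_comm, ← Equiv.prod_comp σ]
      simp
    have h5 : ∀ v w : Fin n → E, (Fintype.card (Equiv.Perm (Fin n)) : ℂ) *
        ∑ π : Equiv.Perm (Fin n), (∏ i, ⟪v i, w (π i)⟫_ℂ) * (q : ℂ) ^ inversions π =
        ∑ σ : Equiv.Perm (Fin n), ∑ τ : Equiv.Perm (Fin n), (q : ℂ) ^ inversions (τ * σ⁻¹) *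
          ∏ i, ⟪v (σ i), w (τ i)⟫_ℂ := by
      intro v w
      rw [← Finset.sum_congr rfl fun σ _ => h4 v w σ, Finset.sum_const, nsmul_eq_mul]
      rfl
    rw [h3]
    simp only [dotProduct, Matrix.mulVec, Fintype.sum_prod_type, Pi.star_apply, M, Matrix.of_apply,
      RCLike.star_def, Finset.mul_sum]
    refine Finset.sum_congr rfl fun v _ => ?_
    symm
    rw [Finset.sum_comm]
    refine Finset.sum_congr rfl fun w _ => ?_
    symm
    have := congrArg (fun z => conj (c v) * c w * z) (h5 v w)
    simp only [Finset.mul_sum] at this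
    convert this using 1
    · exact Finset.sum_congr rfl fun _ _ => by ring
    · exact Finset.sum_congr rfl fun _ _ => Finset.sum_congr rfl fun _ _ => by ring
  rw [← key] at h
  have hpos : (0 : ℂ) < (Fintype.card (Equiv.Perm (Fin n)) : ℂ) := by
    exact_mod_cast Fintype.card_pos
  exact le_of_mul_le_mul_left (by simpa using h) hpos

/-! ### The algebraic Fock space -/

/-- The algebraic Fock space `ℂΩ ⊕ E ⊕ E^{⊗2} ⊕ ⋯`, to be equipped with the form `⟨·,·⟩_q`. -/
def AlgFock (_q : Set.Ioo (-1 : ℝ) 1) (E : Type*) [NormedAddCommGroup E] [InnerProductSpace ℂ E] :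
    Type _ :=
  DirectSum ℕ fun n => ⨂[ℂ]^n E

namespace AlgFock

variable (q : Set.Ioo (-1 : ℝ) 1)

instance : AddCommGroup (AlgFock q E) :=
  inferInstanceAs (AddCommGroup (DirectSum ℕ fun n => ⨂[ℂ]^n E))

instance : Module ℂ (AlgFock q E) :=
  inferInstanceAs (Module ℂ (DirectSum ℕ fun n => ⨂[ℂ]^n E))

/-- The inclusion of `E^{⊗n}`. -/
def incl (n : ℕ) : (⨂[ℂ]^n E) →ₗ[ℂ] AlgFock q E :=
  DirectSum.lof ℂ ℕ (fun n => ⨂[ℂ]^n E) n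

/-- The component in `E^{⊗n}`. -/
def comp (n : ℕ) : AlgFock q E →ₗ[ℂ] (⨂[ℂ]^n E) :=
  DirectSum.component ℂ ℕ (fun n => ⨂[ℂ]^n E) n

/-- The linear map with given restrictions to the tensor powers. -/
def desc {M : Type*} [AddCommGroup M] [Module ℂ M] (φ : ∀ n, (⨂[ℂ]^n E) →ₗ[ℂ] M) :
    AlgFock q E →ₗ[ℂ] M :=
  DirectSum.toModule ℂ ℕ M φ

/-- The elementary tensor `f₁ ⊗ ⋯ ⊗ fₙ`. -/
def elem {n : ℕ} (f : Fin n → E) : AlgFock q E := incl q n (PiTensorProduct.tprod ℂ f)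

variable {q}

theorem desc_incl {M : Type*} [AddCommGroup M] [Module ℂ M] (φ : ∀ n, (⨂[ℂ]^n E) →ₗ[ℂ] M) (n : ℕ)
    (x : ⨂[ℂ]^n E) : desc q φ (incl q n x) = φ n x :=
  DirectSum.toModule_lof (R := ℂ) (M := fun n => ⨂[ℂ]^n E) (φ := φ) n x

theorem comp_incl_self (n : ℕ) (x : ⨂[ℂ]^n E) : comp q n (incl q n x) = x :=
  DirectSum.component.lof_self (R := ℂ) (M := fun n => ⨂[ℂ]^n E) n x

theorem comp_incl_of_ne {m n : ℕ} (h : m ≠ n) (x : ⨂[ℂ]^m E) : comp q n (incl q m x) = 0 :=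
  DirectSum.of_eq_of_ne _ _ _ h.symm

theorem induction {P : AlgFock q E → Prop} (h1 : ∀ (n : ℕ) (r : ℂ) (f : Fin n → E), P (r • elem q f))
    (h2 : ∀ x y, P x → P y → P (x + y)) (x : AlgFock q E) : P x := by
  have h0 : P 0 := by simpa using h1 0 0 Fin.elim0
  refine DirectSum.induction_on x h0 (fun n z => ?_) h2
  change P (incl q n z)
  induction z using PiTensorProduct.induction_on with
  | smul_tprod r f => simpa [elem] using h1 n r f
  | add z w hz hw => rw [map_add]; exact h2 _ _ hz hw

theorem sum_incl (x : AlgFock q E) : ∃ s : Finset ℕ, x = ∑ n ∈ s, incl q n (comp q n x) := by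
  classical
  exact ⟨DFinsupp.support x, (DirectSum.sum_support_of x).symm⟩

variable (q)

/-- `(x, y) ↦ conj ⟨x, y⟩_q`, linear in `x` and conjugate linear in `y`. -/
def conjForm : AlgFock q E →ₗ[ℂ] (AlgFock q E →ₗ⋆[ℂ] ℂ) :=
  desc q fun n =>
    { toFun := fun x => (QFock.conjForm (q : ℝ) n x).comp (comp q n)
      map_add' := fun x y => by ext z; simp
      map_smul' := fun c x => by ext z; simp }

/-- The hermitian form `⟨x, y⟩_q`, for which different tensor powers are orthogonal. -/
def form (x y : AlgFock q E) : ℂ := conj (conjForm q x y)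

variable {q}

theorem form_incl_incl (m n : ℕ) (x : ⨂[ℂ]^m E) (y : ⨂[ℂ]^n E) :
    form q (incl q m x) (incl q n y) =
      if h : m = n then tensorForm (q : ℝ) n (h ▸ x) y else 0 := by
  split_ifs with h
  · subst h
    simp [form, conjForm, desc_incl, comp_incl_self, tensorForm]
  · simp [form, conjForm, desc_incl, comp_incl_of_ne (Ne.symm h)]

/-- On elementary tensors, `form` is given by the sum over permutations. -/
theorem form_elem_elem {n : ℕ} (f g : Fin n → E) :
    form q (elem q f) (elem q g) =
      ∑ π : Equiv.Perm (Fin n), (∏ i, ⟪f i, g (π i)⟫_ℂ) * ((q : ℝ) : ℂ) ^ inversions π := by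
  simp [elem, form_incl_incl, tensorForm_tprod]

theorem form_elem_elem_of_ne {m n : ℕ} (h : m ≠ n) (f : Fin m → E) (g : Fin n → E) :
    form q (elem q f) (elem q g) = 0 := by
  simp [elem, form_incl_incl, h]

theorem form_add_left (x y z : AlgFock q E) : form q (x + y) z = form q x z + form q y z := by
  simp [form]

theorem form_add_right (x y z : AlgFock q E) : form q x (y + z) = form q x y + form q x z := by
  simp [form]

theorem form_smul_left (c : ℂ) (x y : AlgFock q E) : form q (c • x) y = conj c * form q x y := by
  simp [form]

theorem form_smul_right (c : ℂ) (x y : AlgFock q E) : form q x (c • y) = c * form q x y := by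
  simp [form]

theorem form_sum_sum {ι : Type*} (s : Finset ι) (x y : ι → AlgFock q E) :
    form q (∑ i ∈ s, x i) (∑ j ∈ s, y j) = ∑ i ∈ s, ∑ j ∈ s, form q (x i) (y j) := by
  simp only [form, map_sum, LinearMap.sum_apply]
  exact Finset.sum_comm

theorem form_symm (x y : AlgFock q E) : conj (form q y x) = form q x y := by
  induction x using induction with
  | h2 x x' hx hx' => simp only [form_add_left, form_add_right, map_add, hx, hx']
  | h1 m r f =>
    induction y using induction with
    | h2 y y' hy hy' => simp only [form_add_left, form_add_right, map_add, hy, hy']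
    | h1 n s g =>
      simp only [form_smul_left, form_smul_right, map_mul, Complex.conj_conj]
      by_cases h : m = n
      · subst h
        simp only [elem, form_incl_incl, dite_true, tensorForm_symm]
        ring
      · simp [form_elem_elem_of_ne h, form_elem_elem_of_ne (Ne.symm h)]

theorem form_self_nonneg (x : AlgFock q E) : 0 ≤ form q x x := by
  obtain ⟨s, hs⟩ := sum_incl x
  have hq : |(q : ℝ)| ≤ 1 := (abs_lt.2 q.2).le
  have h : form q x x = ∑ n ∈ s, tensorForm (q : ℝ) n (comp q n x) (comp q n x) := by
    conv_lhs => rw [hs]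
    rw [form_sum_sum]
    simp only [form_incl_incl]
    refine Finset.sum_congr rfl fun n hn => ?_
    rw [Finset.sum_eq_single n]
    · simp
    · intro m _ hm
      simp [hm.symm]
    · exact fun h => absurd hn h
  rw [h]
  exact Finset.sum_nonneg fun n _ => tensorForm_nonneg _ hq n _

variable (E q) in
/-- The form as a (positive semidefinite) inner product. -/
@[reducible]
def core : PreInnerProductSpace.Core ℂ (AlgFock q E) where
  inner x y := form q x y
  conj_inner_symm x y := form_symm x y
  re_inner_nonneg x := (Complex.nonneg_iff.1 (form_self_nonneg x)).1
  add_left := form_add_left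
  smul_left x y c := form_smul_left c x y

instance : SeminormedAddCommGroup (AlgFock q E) :=
  @InnerProductSpace.Core.toSeminormedAddCommGroup ℂ _ _ _ _ (core E q)

instance : InnerProductSpace ℂ (AlgFock q E) :=
  InnerProductSpace.ofCore (core E q)

theorem inner_def (x y : AlgFock q E) : ⟪x, y⟫_ℂ = form q x y := rfl

/-! ### Creation and annihilation operators -/

/-- `f₁ ⊗ ⋯ ⊗ fₙ ↦ f ⊗ f₁ ⊗ ⋯ ⊗ fₙ`. -/
def tensorCreate (n : ℕ) (f : E) : (⨂[ℂ]^n E) →ₗ[ℂ] (⨂[ℂ]^(n + 1) E) :=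
  PiTensorProduct.lift
    ((PiTensorProduct.tprod ℂ (s := fun _ : Fin (n + 1) => E)).curryLeft f)

theorem tensorCreate_tprod (n : ℕ) (f : E) (g : Fin n → E) :
    tensorCreate n f (PiTensorProduct.tprod ℂ g) = PiTensorProduct.tprod ℂ (Fin.cons f g) := by
  simp [tensorCreate]

variable (q)

/-- `f₁ ⊗ ⋯ ⊗ fₙ₊₁ ↦ ∑ᵢ qⁱ⁻¹ ⟨f, fᵢ⟩ f₁ ⊗ ⋯ ⊗ f̂ᵢ ⊗ ⋯ ⊗ fₙ₊₁`. -/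
def tensorAnnihilate (n : ℕ) (f : E) : (⨂[ℂ]^(n + 1) E) →ₗ[ℂ] (⨂[ℂ]^n E) :=
  PiTensorProduct.lift (∑ i : Fin (n + 1), (((q : ℝ) : ℂ) ^ (i : ℕ)) •
    LinearMap.uncurryMid i
      ((innerSL ℂ f).toLinearMap.smulRight (PiTensorProduct.tprod ℂ (s := fun _ : Fin n => E))))

theorem tensorAnnihilate_tprod (n : ℕ) (f : E) (g : Fin (n + 1) → E) :
    tensorAnnihilate q n f (PiTensorProduct.tprod ℂ g) =
      ∑ i : Fin (n + 1), (((q : ℝ) : ℂ) ^ (i : ℕ) * ⟪f, g i⟫_ℂ) •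
        PiTensorProduct.tprod ℂ (i.removeNth g) := by
  simp [tensorAnnihilate, mul_smul]

/-- The creation operator `a⁺(f)` on the algebraic Fock space. -/
def create (f : E) : AlgFock q E →ₗ[ℂ] AlgFock q E :=
  desc q fun n => incl q (n + 1) ∘ₗ tensorCreate n f

/-- The annihilation operator `a⁻(f)` on the algebraic Fock space. -/
def annihilate (f : E) : AlgFock q E →ₗ[ℂ] AlgFock q E :=
  desc q fun n =>
    match n with
    | 0 => 0
    | n + 1 => incl q n ∘ₗ tensorAnnihilate q n f

variable {q}

theorem create_elem {n : ℕ} (f : E) (g : Fin n → E) :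
    create q f (elem q g) = elem q (Fin.cons f g : Fin (n + 1) → E) := by
  simp [create, elem, desc_incl, tensorCreate_tprod]

theorem annihilate_elem_zero (f : E) (g : Fin 0 → E) : annihilate q f (elem q g) = 0 := by
  simp [annihilate, elem, desc_incl]

theorem annihilate_elem_succ {n : ℕ} (f : E) (g : Fin (n + 1) → E) :
    annihilate q f (elem q g) = ∑ i : Fin (n + 1),
      (((q : ℝ) : ℂ) ^ (i : ℕ) * ⟪f, g i⟫_ℂ) • elem q (i.removeNth g) := by
  simp [annihilate, elem, desc_incl, tensorAnnihilate_tprod]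

/-- `a⁻(f) a⁺(f) = q a⁺(f) a⁻(f) + ‖f‖²`. -/
theorem annihilate_create (f : E) (x : AlgFock q E) :
    annihilate q f (create q f x) =
      ((q : ℝ) : ℂ) • create q f (annihilate q f x) + ⟪f, f⟫_ℂ • x := by
  induction x using induction with
  | h2 x y hx hy => simp only [map_add, hx, hy, smul_add]; abel
  | h1 n r g =>
    have h : annihilate q f (create q f (elem q g)) =
      ((q : ℝ) : ℂ) • create q f (annihilate q f (elem q g)) + ⟪f, f⟫_ℂ • elem q g := by
      rw [create_elem, annihilate_elem_succ, Fin.sum_univ_succ, add_comm]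
      congr 1
      · cases n with
        | zero => simp [annihilate_elem_zero]
        | succ n =>
          rw [annihilate_elem_succ, map_sum, Finset.smul_sum]
          refine Finset.sum_congr rfl fun i _ => ?_
          rw [map_smul, create_elem, smul_smul]
          congr 1
          · simp [pow_succ]
            ring
          · congr 1
            funext j
            refine Fin.cases ?_ (fun j => ?_) j <;> simp [Fin.removeNth]
      · simp
    simp only [map_smul, h, smul_add]
    rw [smul_comm r, smul_comm r ⟪f, f⟫_ℂ]

/-- The permutation with `0 ↦ p` which is otherwise `π`, up to the order preserving bijections of
`Fin n` with the complements of `0` and `p`. -/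
def insertPerm {n : ℕ} (p : Fin (n + 1)) (π : Equiv.Perm (Fin n)) : Equiv.Perm (Fin (n + 1)) :=
  (finSuccEquiv' 0).trans ((Equiv.optionCongr π).trans (finSuccEquiv' p).symm)

theorem insertPerm_zero {n : ℕ} (p : Fin (n + 1)) (π : Equiv.Perm (Fin n)) :
    insertPerm p π 0 = p := by
  simp [insertPerm]

theorem insertPerm_succ {n : ℕ} (p : Fin (n + 1)) (π : Equiv.Perm (Fin n)) (i : Fin n) :
    insertPerm p π i.succ = p.succAbove (π i) := by
  have h : finSuccEquiv' (0 : Fin (n + 1)) i.succ = some i := by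
    rw [← Fin.succAbove_zero, finSuccEquiv'_succAbove]
  simp [insertPerm, h]

theorem insertPerm_bijective (n : ℕ) : Function.Bijective
    (fun x : Fin (n + 1) × Equiv.Perm (Fin n) => insertPerm x.1 x.2) := by
  rw [Fintype.bijective_iff_injective_and_card]
  constructor
  · rintro ⟨p, π⟩ ⟨p', π'⟩ h
    have h0 : p = p' := by simpa [insertPerm_zero] using DFunLike.congr_fun h 0
    subst h0
    congr 1
    ext1 i
    simpa [insertPerm_succ] using DFunLike.congr_fun h i.succ
  · simp [Fintype.card_perm, Nat.factorial_succ]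

theorem inversions_insertPerm {n : ℕ} (p : Fin (n + 1)) (π : Equiv.Perm (Fin n)) :
    inversions (insertPerm p π) = p + inversions π := by
  have h : ∀ {m : ℕ} (σ : Equiv.Perm (Fin m)),
      inversions σ = ∑ i, ∑ j, if i < j ∧ σ j < σ i then 1 else 0 := by
    intro m σ
    rw [inversions, Finset.card_filter, Fintype.sum_prod_type]
  rw [h, h, Fin.sum_univ_succ]
  congr 1
  · rw [Fin.sum_univ_succ]
    simp only [insertPerm_zero, insertPerm_succ, lt_irrefl, false_and, if_false, zero_add,
      Fin.succ_pos, true_and]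
    rw [Equiv.sum_comp π (fun j => if p.succAbove j < p then 1 else 0)]
    simp only [Fin.succAbove_lt_iff_castSucc_lt, Finset.sum_boole, Nat.cast_id]
    have : (Finset.univ.filter fun j : Fin n => j.castSucc < p).card =
        (Finset.range (p : ℕ)).card := by
      refine Finset.card_bij (fun j _ => (j : ℕ)) ?_ ?_ ?_
      · intro j hj
        simpa [Fin.lt_def] using hj
      · intro j _ k _ hjk
        exact Fin.ext hjk
      · intro k hk
        have hk' : k < p := by simpa using hk
        exact ⟨⟨k, by omega⟩, by simpa [Fin.lt_def] using hk', rfl⟩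
    simpa using this
  · refine Finset.sum_congr rfl fun i _ => ?_
    rw [Fin.sum_univ_succ]
    simp [insertPerm_succ, Fin.succAbove_lt_succAbove_iff]

/-- `a⁻(f)` is the adjoint of `a⁺(f)`. -/
theorem form_create (f : E) (x y : AlgFock q E) :
    form q (create q f x) y = form q x (annihilate q f y) := by
  induction x using induction with
  | h2 x x' hx hx' => simp only [map_add, form_add_left, hx, hx']
  | h1 m r g =>
    induction y using induction with
    | h2 y y' hy hy' => simp only [map_add, form_add_right, hy, hy']
    | h1 n s k =>
      simp only [map_smul, form_smul_left, form_smul_right]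
      congr 2
      rw [create_elem]
      cases n with
      | zero =>
        rw [annihilate_elem_zero, form_elem_elem_of_ne (Nat.succ_ne_zero m)]
        simp [form]
      | succ n =>
        rw [annihilate_elem_succ]
        by_cases h : m = n
        · subst h
          have hs : form q (elem q g) (∑ i : Fin (m + 1),
              (((q : ℝ) : ℂ) ^ (i : ℕ) * ⟪f, k i⟫_ℂ) • elem q (i.removeNth k)) =
              ∑ i : Fin (m + 1), (((q : ℝ) : ℂ) ^ (i : ℕ) * ⟪f, k i⟫_ℂ) *
                form q (elem q g) (elem q (i.removeNth k)) := by
            simp only [form, map_sum, LinearMap.map_smulₛₗ, smul_eq_mul, map_mul,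
              Complex.conj_conj]
          rw [hs, form_elem_elem]
          rw [← (insertPerm_bijective m).sum_comp, Fintype.sum_prod_type]
          refine Finset.sum_congr rfl fun p _ => ?_
          rw [form_elem_elem, Finset.mul_sum]
          refine Finset.sum_congr rfl fun π _ => ?_
          rw [Fin.prod_univ_succ, inversions_insertPerm, pow_add]
          simp only [insertPerm_zero, insertPerm_succ, Fin.cons_zero, Fin.cons_succ, Fin.removeNth]
          ring
        · have hs : ∀ i : Fin (n + 1), form q (elem q g) (elem q (i.removeNth k)) = 0 :=
            fun i => form_elem_elem_of_ne h _ _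
          rw [form_elem_elem_of_ne (by omega)]
          simp only [form, map_eq_zero] at hs
          simp [form, hs]

/-- The vectors with components in `E^{⊗m}`, `m ≤ n`, only. -/
def IsLow (n : ℕ) (x : AlgFock q E) : Prop :=
  x ∈ Submodule.span ℂ {z | ∃ m ≤ n, ∃ f : Fin m → E, z = elem q f}

theorem isLow_annihilate {n : ℕ} (f : E) {x : AlgFock q E} (hx : IsLow (n + 1) x) :
    IsLow n (annihilate q f x) := by
  unfold IsLow at hx ⊢
  induction hx using Submodule.span_induction with
  | mem z hz =>
    obtain ⟨m, hm, g, rfl⟩ := hz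
    cases m with
    | zero => rw [annihilate_elem_zero]; exact zero_mem _
    | succ m =>
      rw [annihilate_elem_succ]
      exact sum_mem fun i _ => Submodule.smul_mem _ _
        (Submodule.subset_span ⟨m, by omega, _, rfl⟩)
  | zero => simp
  | add x y _ _ hx hy => rw [map_add]; exact add_mem hx hy
  | smul c x _ hx => rw [map_smul]; exact Submodule.smul_mem _ _ hx

theorem annihilate_of_isLow_zero (f : E) {x : AlgFock q E} (hx : IsLow 0 x) :
    annihilate q f x = 0 := by
  unfold IsLow at hx
  induction hx using Submodule.span_induction with
  | mem z hz =>
    obtain ⟨m, hm, g, rfl⟩ := hz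
    obtain rfl : m = 0 := by omega
    exact annihilate_elem_zero f g
  | zero => simp
  | add x y _ _ hx hy => rw [map_add, hx, hy, add_zero]
  | smul c x _ hx => rw [map_smul, hx, smul_zero]

theorem exists_isLow (x : AlgFock q E) : ∃ n, IsLow n x := by
  induction x using induction with
  | h1 n r f => exact ⟨n, Submodule.smul_mem _ _ (Submodule.subset_span ⟨n, le_rfl, f, rfl⟩)⟩
  | h2 x y hx hy =>
    obtain ⟨m, hm⟩ := hx
    obtain ⟨n, hn⟩ := hy
    refine ⟨max m n, add_mem (Submodule.span_mono ?_ hm) (Submodule.span_mono ?_ hn)⟩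
    · rintro z ⟨k, hk, f, rfl⟩
      exact ⟨k, hk.trans (le_max_left _ _), f, rfl⟩
    · rintro z ⟨k, hk, f, rfl⟩
      exact ⟨k, hk.trans (le_max_right _ _), f, rfl⟩

/-- A bound for the norms of `a⁺(f)` and `a⁻(f)`. -/
def bound (q : Set.Ioo (-1 : ℝ) 1) (f : E) : ℝ := √(‖f‖ ^ 2 / (1 - |(q : ℝ)|))

theorem norm_le_aux (f : E) (n : ℕ) : ∀ x : AlgFock q E, IsLow n x →
    ‖annihilate q f x‖ ≤ bound q f * ‖x‖ ∧ ‖create q f x‖ ≤ bound q f * ‖x‖ := by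
  have hq : |(q : ℝ)| < 1 := abs_lt.2 q.2
  have hb : bound q f ^ 2 = ‖f‖ ^ 2 / (1 - |(q : ℝ)|) :=
    Real.sq_sqrt (div_nonneg (by positivity) (by linarith))
  have hb' : |(q : ℝ)| * bound q f ^ 2 + ‖f‖ ^ 2 = bound q f ^ 2 := by
    rw [hb]
    have : (1 - |(q : ℝ)|) ≠ 0 := by linarith
    field_simp
    ring
  have hb0 : 0 ≤ bound q f := Real.sqrt_nonneg _
  have step : ∀ x : AlgFock q E, ‖annihilate q f x‖ ≤ bound q f * ‖x‖ →
      ‖create q f x‖ ≤ bound q f * ‖x‖ := by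
    intro x hx
    have h1 : ‖create q f x‖ ^ 2 = (q : ℝ) * ‖annihilate q f x‖ ^ 2 + ‖f‖ ^ 2 * ‖x‖ ^ 2 := by
      have h2 : ⟪create q f x, create q f x⟫_ℂ =
          ((q : ℝ) : ℂ) * ⟪annihilate q f x, annihilate q f x⟫_ℂ + ⟪f, f⟫_ℂ * ⟪x, x⟫_ℂ := by
        have h3 : ⟪annihilate q f x, annihilate q f x⟫_ℂ =
            ⟪x, create q f (annihilate q f x)⟫_ℂ := by
          rw [← inner_conj_symm x, inner_def, inner_def, form_create, form_symm]
        rw [h3, inner_def, form_create, annihilate_create, form_add_right, form_smul_right,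
          form_smul_right]
        rfl
      rw [inner_self_eq_norm_sq_to_K, inner_self_eq_norm_sq_to_K, inner_self_eq_norm_sq_to_K,
        inner_self_eq_norm_sq_to_K] at h2
      apply Complex.ofReal_injective
      push_cast
      exact h2
    refine abs_le_of_sq_le_sq' ?_ (by positivity) |>.2
    rw [h1, mul_pow, ← hb', add_mul]
    gcongr ?_ + _
    calc (q : ℝ) * ‖annihilate q f x‖ ^ 2 ≤ |(q : ℝ)| * ‖annihilate q f x‖ ^ 2 := by
          gcongr; exact le_abs_self _
      _ ≤ |(q : ℝ)| * (bound q f * ‖x‖) ^ 2 := by gcongr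
      _ = _ := by ring
  induction n with
  | zero =>
    intro x hx
    have h : ‖annihilate q f x‖ ≤ bound q f * ‖x‖ := by
      rw [annihilate_of_isLow_zero f hx, norm_zero]
      positivity
    exact ⟨h, step x h⟩
  | succ n ih =>
    intro x hx
    have h : ‖annihilate q f x‖ ≤ bound q f * ‖x‖ := by
      have h1 := (ih _ (isLow_annihilate f hx)).2
      have h2 : ‖annihilate q f x‖ ^ 2 ≤ ‖create q f (annihilate q f x)‖ * ‖x‖ := by
        have h3 : ⟪create q f (annihilate q f x), x⟫_ℂ =
            ⟪annihilate q f x, annihilate q f x⟫_ℂ := form_create f _ _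
        have h4 := norm_inner_le_norm (𝕜 := ℂ) (create q f (annihilate q f x)) x
        rw [h3, inner_self_eq_norm_sq_to_K] at h4
        simpa using h4
      by_cases h0 : ‖annihilate q f x‖ = 0
      · rw [h0]; positivity
      · have h5 : 0 < ‖annihilate q f x‖ := lt_of_le_of_ne (norm_nonneg _) (Ne.symm h0)
        have h6 : ‖create q f (annihilate q f x)‖ * ‖x‖ ≤
            bound q f * ‖annihilate q f x‖ * ‖x‖ := by gcongr
        refine le_of_mul_le_mul_left ?_ h5
        nlinarith
    exact ⟨h, step x h⟩

variable (q)

/-- `a⁺(f)` as a bounded operator. -/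
def createCLM (f : E) : AlgFock q E →L[ℂ] AlgFock q E :=
  (create q f).mkContinuous (bound q f) fun x =>
    let ⟨n, hn⟩ := exists_isLow x
    (norm_le_aux f n x hn).2

/-- `a⁻(f)` as a bounded operator. -/
def annihilateCLM (f : E) : AlgFock q E →L[ℂ] AlgFock q E :=
  (annihilate q f).mkContinuous (bound q f) fun x =>
    let ⟨n, hn⟩ := exists_isLow x
    (norm_le_aux f n x hn).1

end AlgFock

/-! ### The `q`-Fock space and `q`-Gaussians -/

section Fock

variable (q : Set.Ioo (-1 : ℝ) 1)

variable {H₀ : Type*} [NormedAddCommGroup H₀] [InnerProductSpace ℝ H₀]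

/-- The `q`-Fock space of the complexification of `H₀`: the Hilbert space completion of the
algebraic Fock space. -/
abbrev Fock (H₀ : Type*) [NormedAddCommGroup H₀] [InnerProductSpace ℝ H₀] : Type _ :=
  UniformSpace.Completion (AlgFock q (Complexification H₀))

/-- The vacuum vector `Ω`. -/
def vacuum : Fock q H₀ :=
  ((AlgFock.elem q (Fin.elim0 : Fin 0 → Complexification H₀) : AlgFock q (Complexification H₀)) :
    Fock q H₀)

/-- The creation operator `a⁺(f)`, `f ∈ H₀`. -/
def creation (f : H₀) : Fock q H₀ →L[ℂ] Fock q H₀ :=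
  (AlgFock.createCLM q (Complexification.ofReal f)).completion

/-- The annihilation operator `a⁻(f)`, `f ∈ H₀`. -/
def annihilation (f : H₀) : Fock q H₀ →L[ℂ] Fock q H₀ :=
  (AlgFock.annihilateCLM q (Complexification.ofReal f)).completion

/-- The `q`-Gaussian `φ(f) = a⁺(f) + a⁻(f)`. -/
def gaussian (f : H₀) : Fock q H₀ →L[ℂ] Fock q H₀ := creation q f + annihilation q f

/-- The vacuum state `𝔼(T) = ⟨TΩ, Ω⟩`; Mathlib's inner product is linear in the second variable. -/
def vacuumState (T : Fock q H₀ →L[ℂ] Fock q H₀) : ℂ := ⟪vacuum q, T (vacuum q)⟫_ℂ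

/-- The `q`-Wick product `:φ(f₁) ⋯ φ(fₙ): = W(f₁, …, fₙ)`, the sum over all decompositions
`[n] = I ⊔ J` of `q ^ #{(i, j) ∈ I × J : j < i}` times the product of the `a⁺(fᵢ)`, `i ∈ I`, in
increasing order of the indices, followed by the product of the `a⁻(fⱼ)`, `j ∈ J`, in increasing
order of the indices. -/
def wick {n : ℕ} (f : Fin n → H₀) : Fock q H₀ →L[ℂ] Fock q H₀ :=
  ∑ I : Finset (Fin n),
    (((q : ℝ) : ℂ) ^ ((I ×ˢ Iᶜ).filter fun p => p.2 < p.1).card) •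
      (((I.sort (· ≤ ·)).map fun i => creation q (f i)).prod *
        ((Iᶜ.sort (· ≤ ·)).map fun j => annihilation q (f j)).prod)

end Fock

/-! ### Feynman diagrams -/

section Feynman

variable {S : Type*} [LinearOrder S] [Fintype S]

/-- A Feynman diagram on `S`, a partition of `S` into sets of one or two elements, given as the set
of its two element members `{i, j}`, written as ordered pairs `(i, j)` with `i < j`. -/
def IsFeynmanDiagram (γ : Finset (S × S)) : Prop :=
  (∀ p ∈ γ, p.1 < p.2) ∧
    ∀ p ∈ γ, ∀ r ∈ γ, p ≠ r → p.1 ≠ r.1 ∧ p.1 ≠ r.2 ∧ p.2 ≠ r.1 ∧ p.2 ≠ r.2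

/-- The vertices which are not paired. -/
def singletons (γ : Finset (S × S)) : Finset S :=
  Finset.univ.filter fun k => ∀ p ∈ γ, p.1 ≠ k ∧ p.2 ≠ k

/-- The number of left crossings `k < i < l < j` of `(i, j)` with `(k, l) ∈ γ`. -/
def leftCrossings (γ : Finset (S × S)) (p : S × S) : ℕ :=
  (γ.filter fun r => r.1 < p.1 ∧ p.1 < r.2 ∧ r.2 < p.2).card

/-- The crossing number `c(γ)`. -/
def crossingNumber (γ : Finset (S × S)) : ℕ := ∑ p ∈ γ, leftCrossings γ p

/-- The number `d(γ)` of degenerate crossings `i < k < j` with `(i, j) ∈ γ` and `k` unpaired. -/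
def degenerateCrossings (γ : Finset (S × S)) : ℕ :=
  ((γ ×ˢ singletons γ).filter fun x => x.1.1 < x.2 ∧ x.2 < x.1.2).card

/-- The total crossing number `tc(γ) = c(γ) + d(γ)`. -/
def totalCrossingNumber (γ : Finset (S × S)) : ℕ := crossingNumber γ + degenerateCrossings γ

/-- For `ξₛ = φ(f s)`, `s ∈ S`, the operator `:v(γ):`, that is, the product of the covariances
`𝔼(ξᵢ ξⱼ)`, `(i, j) ∈ γ`, times the Wick product of the unpaired `ξₕ` in increasing order. -/
def wickDiagram (q : Set.Ioo (-1 : ℝ) 1) {H₀ : Type*} [NormedAddCommGroup H₀]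
    [InnerProductSpace ℝ H₀] (f : S → H₀) (γ : Finset (S × S)) : Fock q H₀ →L[ℂ] Fock q H₀ :=
  (∏ p ∈ γ, vacuumState q (gaussian q (f p.1) * gaussian q (f p.2))) •
    wick q fun k => f ((singletons γ).orderEmbOfFin rfl k)

end Feynman

open Classical in
/-- The Feynman diagrams on the vertices `(p, k)`, `k < n p`, in lexicographic order, which do not
link vertices within a block, that is, vertices with the same `p`. -/
def blockDiagrams {t : ℕ} (n : Fin t → ℕ) :
    Finset (Finset ((Σₗ p : Fin t, Fin (n p)) × (Σₗ p : Fin t, Fin (n p)))) :=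
  Finset.univ.filter fun γ => IsFeynmanDiagram γ ∧ ∀ x ∈ γ, (ofLex x.1).1 ≠ (ofLex x.2).1

end QFock

end

/-!
The operators `a⁺(f)`, `a⁻(f)` satisfy `a⁻(f) a⁺(g) = q a⁺(g) a⁻(f) + ⟨f, g⟩`, and this relation is
all that the product formula uses. The combinatorial part is therefore carried out in an arbitrary
algebra with elements `P s`, `R s` indexed by a linearly ordered set `S` and with the relations
`R i * P j = q P j * R i + c i j`. Both sides of the formula are considered for every finite
`T ⊆ S`, the blocks being cut down to `T`, so that deleting vertices requires no renumbering.

For `m` below all elements of `T`, normal ordering gives (`gaussian_mul_wickOn`)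
`(P m + R m) W(T) = W({m} ∪ T) + ∑_{k ∈ T} q ^ #{s ∈ T : s < k} c m k W(T \ {k})`.
Applied to the first nonempty block, this expresses the product of Wick products over `{m} ∪ T` by
those over `T` and over the sets `T \ {k}`, where `k` is in the block of `m` (`blockProd_insert`).

The sum over diagrams satisfies the same recursion (`diagramSum_insert`). A diagram on `{m} ∪ T`
arises from a diagram on `T` by leaving `m` unpaired, which does not change the total crossing
number, or by linking `m` to an unpaired `k`, which raises it by the number of unpaired `s < k`
(`totalCrossingsOn_insert_insert`). These are the terms of `(P m + R m) W(U)`, `U` being the set of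
unpaired vertices, except that links inside the block of `m` are missing. When `k` is in that block,
each vertex of `T` below `k` is unpaired or is linked across `k`, so that the missing terms add up to
`q ^ #{s ∈ T : s < k} c m k` times the sum over the diagrams on `T \ {k}`
(`totalCrossingsOn_add_card`). The formula follows by induction on the size of `T`.
-/

namespace QFock

open Finset

/-! ### Wick products in an algebra with `q`-commutation relations -/

section Wick

variable {K A S : Type*} [CommRing K] [Ring A] [Algebra K A] [LinearOrder S]

/-- The number of pairs `(i, j) ∈ I × J` with `j < i`. -/
def invs (I J : Finset S) : ℕ := ((I ×ˢ J).filter fun p => p.2 < p.1).card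

/-- The product of the `P i`, `i ∈ I`, in increasing order of the indices. -/
def ordProd (P : S → A) (I : Finset S) : A := ((I.sort (· ≤ ·)).map P).prod

/-- The `q`-Wick product over the finite set `T`, where `P` and `R` give the creation and the
annihilation operators. -/
def wickOn (q : K) (P R : S → A) (T : Finset S) : A :=
  ∑ I ∈ T.powerset, q ^ invs I (T \ I) • (ordProd P I * ordProd R (T \ I))

theorem invs_insert_left {k : S} {I : Finset S} (hk : k ∉ I) (J : Finset S) :
    invs (insert k I) J = invs I J + (J.filter (· < k)).card := by
  simp only [invs, card_filter, sum_product, sum_insert hk]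
  exact add_comm _ _

theorem invs_insert_left_of_lt {m : S} {I J : Finset S} (hI : ∀ s ∈ I, m < s) (hJ : ∀ s ∈ J, m < s) :
    invs (insert m I) J = invs I J := by
  rw [invs_insert_left fun h => (hI m h).false, filter_false_of_mem fun s hs => (hJ s hs).not_gt]
  rfl

theorem invs_insert_right_of_lt {m : S} {I J : Finset S} (hI : ∀ s ∈ I, m < s)
    (hJ : ∀ s ∈ J, m < s) : invs I (insert m J) = I.card + invs I J := by
  have hm : m ∉ J := fun h => (hJ m h).false
  simp only [invs, card_filter, sum_product, sum_insert hm, sum_add_distrib]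
  congr 1
  rw [card_eq_sum_ones]
  exact sum_congr rfl fun s hs => if_pos (hI s hs)

theorem ordProd_empty (P : S → A) : ordProd P ∅ = 1 := by simp [ordProd]

theorem ordProd_insert (P : S → A) {m : S} {I : Finset S} (hI : ∀ s ∈ I, m < s) :
    ordProd P (insert m I) = P m * ordProd P I := by
  rw [ordProd, sort_insert _ (fun s hs => (hI s hs).le) fun h => (hI m h).false]
  rfl

theorem wickOn_empty (q : K) (P R : S → A) : wickOn q P R ∅ = 1 := by
  simp [wickOn, ordProd_empty, invs]

theorem card_filter_lt_insert_of_lt {m k : S} {I : Finset S} (hI : ∀ s ∈ I, m < s) (hk : m < k) :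
    ((insert m I).filter (· < k)).card = (I.filter (· < k)).card + 1 := by
  rw [filter_insert, if_pos hk, card_insert_of_notMem fun h => (hI m (mem_filter.1 h).1).false]

theorem sdiff_insert_of_lt {m : S} {I T : Finset S} (hT : ∀ s ∈ T, m < s) (hI : I ⊆ T) :
    insert m T \ I = insert m (T \ I) :=
  insert_sdiff_of_notMem _ fun h => (hT m (hI h)).false

theorem insert_sdiff_insert_of_lt {m : S} {I T : Finset S} (hT : ∀ s ∈ T, m < s) :
    insert m T \ insert m I = T \ I := by
  rw [insert_sdiff_insert]
  ext s
  simp only [mem_sdiff, mem_insert, not_or]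
  exact ⟨fun h => ⟨h.1, h.2.2⟩, fun h => ⟨h.1, (hT s h.1).ne', h.2⟩⟩

variable {q : K} {P R : S → A} {c : S → S → K}

/-- Moving an annihilation operator to the right through a product of creation operators. -/
theorem annihilation_mul_ordProd (h : ∀ i j, R i * P j = q • (P j * R i) + c i j • 1) (m : S)
    (I : Finset S) :
    R m * ordProd P I = q ^ I.card • (ordProd P I * R m) +
      ∑ k ∈ I, (q ^ (I.filter (· < k)).card * c m k) • ordProd P (I.erase k) := by
  induction I using Finset.induction_on_min with
  | empty => simp [ordProd_empty]
  | insert a I ha ih =>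
    have haI : a ∉ I := fun h => (ha a h).false
    rw [ordProd_insert P ha, ← mul_assoc, h, add_mul, smul_mul_assoc, mul_assoc, ih,
      card_insert_of_notMem haI, sum_insert haI, erase_insert haI]
    have h1 : (insert a I).filter (· < a) = ∅ := by
      refine filter_false_of_mem fun s hs => ?_
      rcases mem_insert.1 hs with rfl | hs
      · exact lt_irrefl _
      · exact (ha s hs).not_gt
    have h2 : ∑ k ∈ I, (q ^ ((insert a I).filter (· < k)).card * c m k) •
        ordProd P ((insert a I).erase k) =
        q • (P a * ∑ k ∈ I, (q ^ (I.filter (· < k)).card * c m k) • ordProd P (I.erase k)) := by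
      rw [mul_sum, smul_sum]
      refine sum_congr rfl fun k hk => ?_
      rw [card_filter_lt_insert_of_lt ha (ha k hk), erase_insert_of_ne (ha k hk).ne,
        ordProd_insert P fun s hs => ha s (mem_of_mem_erase hs), mul_smul_comm, smul_smul]
      congr 1
      ring
    rw [h1, h2, mul_add, smul_add, mul_smul_comm, smul_smul, ← pow_succ', card_empty, pow_zero,
      one_mul, smul_one_mul, mul_assoc (P a)]
    abel

/-- `ξₘ :∏ ξₛ: = :ξₘ ∏ ξₛ: + ∑ₖ q ^ #{s < k} cₘₖ :∏_{s ≠ k} ξₛ:` for `m` below all `s ∈ T`. -/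
theorem gaussian_mul_wickOn (h : ∀ i j, R i * P j = q • (P j * R i) + c i j • 1) {m : S}
    {T : Finset S} (hT : ∀ s ∈ T, m < s) :
    (P m + R m) * wickOn q P R T = wickOn q P R (insert m T) +
      ∑ k ∈ T, (q ^ (T.filter (· < k)).card * c m k) • wickOn q P R (T.erase k) := by
  have hmT : m ∉ T := fun h => (hT m h).false
  have h1 : wickOn q P R (insert m T) = P m * wickOn q P R T +
      ∑ I ∈ T.powerset, q ^ invs I (T \ I) • (q ^ I.card •
        (ordProd P I * R m) * ordProd R (T \ I)) := by
    rw [wickOn, sum_powerset_insert hmT, add_comm, wickOn, mul_sum]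
    congr 1 <;> refine sum_congr rfl fun I hI => ?_ <;> rw [mem_powerset] at hI
    · rw [insert_sdiff_insert_of_lt hT, ordProd_insert P fun s hs => hT s (hI hs),
        invs_insert_left_of_lt (fun s hs => hT s (hI hs)) fun s hs => hT s (sdiff_subset hs),
        mul_smul_comm, mul_assoc]
    · rw [sdiff_insert_of_lt hT hI, ordProd_insert R fun s hs => hT s (sdiff_subset hs),
        invs_insert_right_of_lt (fun s hs => hT s (hI hs)) fun s hs => hT s (sdiff_subset hs),
        pow_add, mul_comm (q ^ _), mul_smul, smul_mul_assoc, mul_assoc]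
  have h2 : ∑ I ∈ T.powerset, ∑ k ∈ I, q ^ invs I (T \ I) •
      ((q ^ (I.filter (· < k)).card * c m k) • (ordProd P (I.erase k) * ordProd R (T \ I))) =
      ∑ k ∈ T, (q ^ (T.filter (· < k)).card * c m k) • wickOn q P R (T.erase k) := by
    -- `I ∋ k` corresponds to the subset `I \ {k}` of `T \ {k}`.
    rw [sum_comm' (t' := T) (s' := fun k => T.powerset.filter (k ∈ ·))]
    · refine sum_congr rfl fun k hk => ?_
      rw [wickOn, smul_sum]
      refine sum_nbij' (fun I => I.erase k) (fun I => insert k I) ?_ ?_ ?_ ?_ ?_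
      · intro I hI
        rw [mem_filter, mem_powerset] at hI
        exact mem_powerset.2 (erase_subset_erase k hI.1)
      · intro I hI
        rw [mem_powerset] at hI
        rw [mem_filter, mem_powerset]
        exact ⟨insert_subset hk (hI.trans (erase_subset _ _)), mem_insert_self _ _⟩
      · intro I hI
        exact insert_erase (mem_filter.1 hI).2
      · intro I hI
        exact erase_insert fun h => notMem_erase k T (mem_powerset.1 hI h)
      · intro I hI
        rw [mem_filter, mem_powerset] at hI
        obtain ⟨I, hkI, rfl⟩ : ∃ J, k ∉ J ∧ I = insert k J :=
          ⟨I.erase k, notMem_erase k I, (insert_erase hI.2).symm⟩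
        have hIT : I ⊆ T := (subset_insert k I).trans hI.1
        have h3 : T.erase k \ I = T \ insert k I := by
          ext s
          grind
        have h4 : (T.filter (· < k)).card =
            (I.filter (· < k)).card + ((T \ insert k I).filter (· < k)).card := by
          rw [← card_union_of_disjoint]
          · congr 1
            ext s
            grind
          · rw [disjoint_left]
            grind
        rw [erase_insert hkI, h3, invs_insert_left hkI, filter_insert, if_neg (lt_irrefl k), h4,
          smul_smul, smul_smul]
        congr 1
        ring
    · intro I k
      rw [mem_powerset, mem_filter, mem_powerset]
      exact ⟨fun h => ⟨h, h.1 h.2⟩, fun h => h.1⟩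
  rw [h1, add_mul, add_assoc, ← h2, ← sum_add_distrib]
  congr 1
  rw [wickOn, mul_sum]
  refine sum_congr rfl fun I _ => ?_
  rw [mul_smul_comm, ← mul_assoc, annihilation_mul_ordProd h, add_mul, smul_add, sum_mul, smul_sum]
  congr 1
  exact sum_congr rfl fun k _ => by rw [smul_mul_assoc]

end Wick

/-! ### Feynman diagrams on finite subsets -/

section Diagrams

variable {S ι : Type*} [LinearOrder S]

open Classical in
/-- The Feynman diagrams with vertices in `T` which do not link vertices of the same block, `b s`
being the block of `s`. -/
noncomputable def diagramsOn (b : S → ι) (T : Finset S) : Finset (Finset (S × S)) :=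
  (T ×ˢ T).powerset.filter fun γ => IsFeynmanDiagram γ ∧ ∀ x ∈ γ, b x.1 ≠ b x.2

/-- The vertices in `T` which are not paired in `γ`. -/
def unpaired (T : Finset S) (γ : Finset (S × S)) : Finset S :=
  T.filter fun k => ∀ p ∈ γ, p.1 ≠ k ∧ p.2 ≠ k

/-- The number of pairs in `γ` which `k` separates. -/
def pairsOver (γ : Finset (S × S)) (k : S) : ℕ := (γ.filter fun p => p.1 < k ∧ k < p.2).card

/-- The number of `i < k < j` with `(i, j) ∈ γ` and `k ∈ U`. -/
def separations (U : Finset S) (γ : Finset (S × S)) : ℕ := ∑ k ∈ U, pairsOver γ k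

/-- The total crossing number of a Feynman diagram on `T`. -/
def totalCrossingsOn (T : Finset S) (γ : Finset (S × S)) : ℕ :=
  crossingNumber γ + separations (unpaired T γ) γ

variable {b : S → ι} {T : Finset S} {γ : Finset (S × S)} {m k : S}

theorem mem_diagramsOn : γ ∈ diagramsOn b T ↔
    γ ⊆ T ×ˢ T ∧ IsFeynmanDiagram γ ∧ ∀ x ∈ γ, b x.1 ≠ b x.2 := by
  simp only [diagramsOn, mem_filter, mem_powerset]

theorem mem_unpaired : k ∈ unpaired T γ ↔ k ∈ T ∧ ∀ p ∈ γ, p.1 ≠ k ∧ p.2 ≠ k := mem_filter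

theorem diagramsOn_subset {T' : Finset S} (h : T ⊆ T') : diagramsOn b T ⊆ diagramsOn b T' := by
  intro γ hγ
  rw [mem_diagramsOn] at hγ ⊢
  exact ⟨hγ.1.trans (product_subset_product h h), hγ.2⟩

theorem diagramsOn_empty (b : S → ι) : diagramsOn b (∅ : Finset S) = {∅} := by
  ext γ
  rw [mem_diagramsOn, mem_singleton, product_empty, subset_empty]
  refine ⟨fun h => h.1, ?_⟩
  rintro rfl
  simp [IsFeynmanDiagram]

theorem mem_diagramsOn_erase : γ ∈ diagramsOn b (T.erase k) ↔
    γ ∈ diagramsOn b T ∧ ∀ p ∈ γ, p.1 ≠ k ∧ p.2 ≠ k := by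
  rw [mem_diagramsOn, mem_diagramsOn]
  constructor
  · rintro ⟨h, h'⟩
    refine ⟨⟨h.trans (product_subset_product (erase_subset _ _) (erase_subset _ _)), h'⟩, ?_⟩
    intro p hp
    have := mem_product.1 (h hp)
    exact ⟨ne_of_mem_erase this.1, ne_of_mem_erase this.2⟩
  · rintro ⟨⟨h, h'⟩, h2⟩
    refine ⟨fun p hp => ?_, h'⟩
    have := mem_product.1 (h hp)
    exact mem_product.2 ⟨mem_erase.2 ⟨(h2 p hp).1, this.1⟩, mem_erase.2 ⟨(h2 p hp).2, this.2⟩⟩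

theorem insert_mem_diagramsOn (hT : ∀ s ∈ T, m < s) (hγ : γ ∈ diagramsOn b T)
    (hk : k ∈ unpaired T γ) (hb : b k ≠ b m) :
    insert (m, k) γ ∈ diagramsOn b (insert m T) := by
  rw [mem_diagramsOn] at hγ ⊢
  rw [mem_unpaired] at hk
  obtain ⟨h1, ⟨h2, h3⟩, h4⟩ := hγ
  have h5 : ∀ p ∈ γ, m < p.1 ∧ m < p.2 := fun p hp =>
    ⟨hT _ (mem_product.1 (h1 hp)).1, hT _ (mem_product.1 (h1 hp)).2⟩
  have hmk := hT k hk.1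
  refine ⟨?_, ⟨?_, ?_⟩, ?_⟩
  · refine insert_subset ?_ (h1.trans ?_)
    · simp [hk.1]
    · exact product_subset_product (subset_insert _ _) (subset_insert _ _)
  · intro p hp
    rcases mem_insert.1 hp with rfl | hp
    exacts [hmk, h2 p hp]
  · intro p hp r hr hpr
    rcases mem_insert.1 hp with rfl | hp <;> rcases mem_insert.1 hr with rfl | hr
    · exact absurd rfl hpr
    · exact ⟨(h5 r hr).1.ne, (h5 r hr).2.ne, (hk.2 r hr).1.symm, (hk.2 r hr).2.symm⟩
    · exact ⟨(h5 p hp).1.ne', (hk.2 p hp).1, (h5 p hp).2.ne', (hk.2 p hp).2⟩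
    · exact h3 p hp r hr hpr
  · intro p hp
    rcases mem_insert.1 hp with rfl | hp
    exacts [hb.symm, h4 p hp]

theorem notMem_of_forall_lt (hT : ∀ s ∈ T, m < s) (hγ : γ ∈ diagramsOn b T) (k : S) :
    (m, k) ∉ γ := fun h =>
  (hT m (mem_product.1 ((mem_diagramsOn.1 hγ).1 h)).1).false

/-- In a diagram on `{m} ∪ T`, the least vertex `m` is either unpaired or linked to a vertex `k` which
is unpaired in the diagram on `T` that remains. -/
theorem exists_insert_of_mem_diagramsOn_insert (hT : ∀ s ∈ T, m < s)
    (hγ : γ ∈ diagramsOn b (insert m T)) (hγ' : γ ∉ diagramsOn b T) :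
    ∃ k, ∃ δ ∈ diagramsOn b T, k ∈ unpaired T δ ∧ b k ≠ b m ∧ insert (m, k) δ = γ := by
  have hγ0 := hγ
  rw [mem_diagramsOn] at hγ hγ'
  obtain ⟨h1, ⟨h2, h3⟩, h4⟩ := hγ
  have h5 : ¬ γ ⊆ T ×ˢ T := fun h => hγ' ⟨h, ⟨h2, h3⟩, h4⟩
  obtain ⟨⟨i, k⟩, hx, hxT⟩ := not_subset.1 h5
  have hik : i < k := h2 _ hx
  obtain ⟨hi, hk⟩ := mem_product.1 (h1 hx)
  simp only [mem_insert] at hi hk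
  have hk' : k ∈ T := by
    rcases hk with rfl | hk
    · rcases hi with rfl | hi
      exacts [absurd hik (lt_irrefl _), absurd hik (hT i hi).not_gt]
    · exact hk
  obtain rfl : i = m := hi.resolve_right fun h => hxT (mem_product.2 ⟨h, hk'⟩)
  have h6 : ∀ p ∈ γ.erase (i, k), (i ≠ p.1 ∧ i ≠ p.2) ∧ p.1 ≠ k ∧ p.2 ≠ k := by
    intro p hp
    have := h3 _ hx p (mem_of_mem_erase hp) (ne_of_mem_erase hp).symm
    exact ⟨⟨this.1, this.2.1⟩, this.2.2.1.symm, this.2.2.2.symm⟩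
  refine ⟨k, γ.erase (i, k), ?_, ?_, (h4 _ hx).symm, insert_erase hx⟩
  · rw [mem_diagramsOn]
    refine ⟨fun p hp => ?_, ⟨fun p hp => h2 p (mem_of_mem_erase hp), fun p hp r hr =>
      h3 p (mem_of_mem_erase hp) r (mem_of_mem_erase hr)⟩, fun p hp => h4 p (mem_of_mem_erase hp)⟩
    have h7 := mem_product.1 (h1 (mem_of_mem_erase hp))
    have h8 := (h6 p hp).1
    exact mem_product.2 ⟨(mem_insert.1 h7.1).resolve_left h8.1.symm,
      (mem_insert.1 h7.2).resolve_left h8.2.symm⟩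
  · exact mem_unpaired.2 ⟨hk', fun p hp => (h6 p hp).2⟩

/-- A sum over the diagrams on `{m} ∪ T`, by the partner of the least vertex `m`. -/
theorem sum_diagramsOn_insert [DecidableEq ι] {M : Type*} [AddCommMonoid M]
    (hT : ∀ s ∈ T, m < s) (G : Finset (S × S) → M) :
    ∑ γ ∈ diagramsOn b (insert m T), G γ = ∑ γ ∈ diagramsOn b T, (G γ +
      ∑ k ∈ (unpaired T γ).filter (fun k => b k ≠ b m), G (insert (m, k) γ)) := by
  rw [sum_add_distrib, ← sum_sdiff (diagramsOn_subset (subset_insert m T)), add_comm]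
  congr 1
  rw [sum_sigma']
  symm
  refine sum_bij (fun x _ => insert (m, x.2) x.1) ?_ ?_ ?_ ?_
  · rintro ⟨γ, k⟩ hx
    simp only [mem_sigma, mem_filter] at hx
    refine mem_sdiff.2 ⟨insert_mem_diagramsOn hT hx.1 hx.2.1 hx.2.2, fun h => ?_⟩
    exact notMem_of_forall_lt hT h k (mem_insert_self _ _)
  · rintro ⟨γ, k⟩ hx ⟨δ, l⟩ hy h
    simp only [mem_sigma, mem_filter] at hx hy h
    have h1 := notMem_of_forall_lt hT hx.1
    have h2 := notMem_of_forall_lt hT hy.1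
    have h3 : (m, k) ∈ insert (m, l) δ := h ▸ mem_insert_self _ _
    obtain rfl : k = l := congrArg Prod.snd ((mem_insert.1 h3).resolve_right (h2 k))
    obtain rfl : γ = δ := by rw [← erase_insert (h1 k), h, erase_insert (h2 k)]
    rfl
  · intro γ hγ
    rw [mem_sdiff] at hγ
    obtain ⟨k, δ, h1, h2, h3, h4⟩ := exists_insert_of_mem_diagramsOn_insert hT hγ.1 hγ.2
    exact ⟨⟨δ, k⟩, mem_sigma.2 ⟨h1, mem_filter.2 ⟨h2, h3⟩⟩, h4⟩
  · intros
    rfl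

theorem unpaired_insert (hT : ∀ s ∈ T, m < s) (hγ : γ ∈ diagramsOn b T) :
    unpaired (insert m T) γ = insert m (unpaired T γ) := by
  refine (filter_insert _ _ _).trans (if_pos fun p hp => ?_)
  have := mem_product.1 ((mem_diagramsOn.1 hγ).1 hp)
  exact ⟨(hT _ this.1).ne', (hT _ this.2).ne'⟩

theorem unpaired_insert_insert (hT : ∀ s ∈ T, m < s) :
    unpaired (insert m T) (insert (m, k) γ) = (unpaired T γ).erase k := by
  ext s
  simp only [mem_unpaired, mem_erase, mem_insert, forall_eq_or_imp]
  constructor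
  · rintro ⟨rfl | hs, ⟨h1, h2⟩, h3⟩
    exacts [absurd rfl h1, ⟨Ne.symm h2, hs, h3⟩]
  · rintro ⟨h1, h2, h3⟩
    exact ⟨Or.inr h2, ⟨(hT s h2).ne, h1.symm⟩, h3⟩

theorem unpaired_erase (T : Finset S) (γ : Finset (S × S)) (k : S) :
    unpaired (T.erase k) γ = (unpaired T γ).erase k := by
  ext s
  simp only [mem_unpaired, mem_erase, and_assoc]

theorem separations_eq_erase {U : Finset S} (hk : k ∈ U) :
    separations U γ = separations (U.erase k) γ + pairsOver γ k := by
  rw [separations, separations, sum_erase_add _ _ hk]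

theorem totalCrossingsOn_insert (hT : ∀ s ∈ T, m < s) (hγ : γ ∈ diagramsOn b T) :
    totalCrossingsOn (insert m T) γ = totalCrossingsOn T γ := by
  have hm : m ∉ unpaired T γ := fun h => (hT m (mem_unpaired.1 h).1).false
  have h0 : pairsOver γ m = 0 := by
    rw [pairsOver, card_eq_zero, filter_eq_empty_iff]
    intro p hp h
    exact (hT _ (mem_product.1 ((mem_diagramsOn.1 hγ).1 hp)).1).not_gt h.1
  rw [totalCrossingsOn, totalCrossingsOn, unpaired_insert hT hγ, separations, sum_insert hm, h0,
    zero_add]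
  rfl

theorem crossingNumber_insert (hT : ∀ s ∈ T, m < s) (hγ : γ ∈ diagramsOn b T) (k : S) :
    crossingNumber (insert (m, k) γ) = crossingNumber γ + pairsOver γ k := by
  have hm : ∀ p ∈ γ, m < p.1 := fun p hp => hT _ (mem_product.1 ((mem_diagramsOn.1 hγ).1 hp)).1
  have h0 : leftCrossings (insert (m, k) γ) (m, k) = 0 := by
    rw [leftCrossings, card_eq_zero, filter_eq_empty_iff]
    intro p hp h
    rcases mem_insert.1 hp with rfl | hp
    exacts [lt_irrefl _ h.1, (hm p hp).not_gt h.1]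
  rw [crossingNumber, sum_insert (notMem_of_forall_lt hT hγ k), h0, zero_add, crossingNumber,
    pairsOver, card_filter, ← sum_add_distrib]
  refine sum_congr rfl fun p hp => ?_
  have h1 : (m, k) ∉ γ.filter fun r => r.1 < p.1 ∧ p.1 < r.2 ∧ r.2 < p.2 := fun h =>
    notMem_of_forall_lt hT hγ k (mem_filter.1 h).1
  rw [leftCrossings, filter_insert]
  split_ifs with h2 h3 h3
  · exact card_insert_of_notMem h1
  · exact absurd h2.2 h3
  · exact absurd ⟨hm p hp, h3⟩ h2
  · rfl

/-- Linking the least vertex `m` to `k` adds a crossing for each unpaired vertex below `k`: every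
pair separated by `k` becomes a crossing instead of a degenerate one. -/
theorem totalCrossingsOn_insert_insert (hT : ∀ s ∈ T, m < s) (hγ : γ ∈ diagramsOn b T)
    (hk : k ∈ unpaired T γ) :
    totalCrossingsOn (insert m T) (insert (m, k) γ) =
      totalCrossingsOn T γ + ((unpaired T γ).filter (· < k)).card := by
  have h1 : ∀ s ∈ (unpaired T γ).erase k, pairsOver (insert (m, k) γ) s =
      pairsOver γ s + if s < k then 1 else 0 := by
    intro s hs
    have hms : m < s := hT s (mem_unpaired.1 (mem_of_mem_erase hs)).1
    have h2 : (m, k) ∉ γ.filter fun p => p.1 < s ∧ s < p.2 := fun h =>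
      notMem_of_forall_lt hT hγ k (mem_filter.1 h).1
    rw [pairsOver, filter_insert]
    simp only [hms, true_and]
    split_ifs
    · exact card_insert_of_notMem h2
    · rfl
  have h3 : ((unpaired T γ).filter (· < k)).card = (((unpaired T γ).erase k).filter (· < k)).card := by
    congr 1
    ext s
    simp only [mem_filter, mem_erase]
    exact ⟨fun h => ⟨⟨h.2.ne, h.1⟩, h.2⟩, fun h => ⟨h.1.2, h.2⟩⟩
  rw [totalCrossingsOn, totalCrossingsOn, crossingNumber_insert hT hγ, unpaired_insert_insert hT,
    separations_eq_erase hk, separations, sum_congr rfl h1, sum_add_distrib, h3, card_filter,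
    separations]
  ring

/-- If the blocks are intervals and the block of `k` starts the set `T`, then every vertex below `k`
is either unpaired or the left end of a pair separated by `k`. -/
theorem totalCrossingsOn_add_card [PartialOrder ι] (hb : Monotone b) (hmT : ∀ s ∈ T, m < s)
    (hk : k ∈ T) (hbk : b k = b m) (hγ : γ ∈ diagramsOn b (T.erase k)) :
    totalCrossingsOn T γ + ((unpaired T γ).filter (· < k)).card =
      totalCrossingsOn (T.erase k) γ + (T.filter (· < k)).card := by
  rw [mem_diagramsOn_erase] at hγ
  obtain ⟨hγ, hγk⟩ := hγ
  have hkU : k ∈ unpaired T γ := mem_unpaired.2 ⟨hk, hγk⟩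
  obtain ⟨h1, ⟨h2, h3⟩, h4⟩ := mem_diagramsOn.1 hγ
  have h5 : ∀ p ∈ γ, k < p.2 := by
    intro p hp
    by_contra h
    have h6 : b m ≤ b p.1 := hb (hmT _ (mem_product.1 (h1 hp)).1).le
    have h7 : b p.1 ≤ b p.2 := hb (h2 p hp).le
    have h8 : b p.2 ≤ b k := hb (not_lt.1 h)
    exact h4 p hp (le_antisymm h7 ((h8.trans hbk.le).trans h6))
  have h9 : T.filter (· < k) = (unpaired T γ).filter (· < k) ∪
      (γ.filter fun p => p.1 < k ∧ k < p.2).image Prod.fst := by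
    ext s
    simp only [mem_filter, mem_union, mem_image, mem_unpaired]
    constructor
    · rintro ⟨hs, hsk⟩
      by_cases h : ∀ p ∈ γ, p.1 ≠ s ∧ p.2 ≠ s
      · exact Or.inl ⟨⟨hs, h⟩, hsk⟩
      · push Not at h
        obtain ⟨p, hp, h⟩ := h
        have hps : p.1 = s := by
          by_contra h'
          exact (h5 p hp).not_gt (h h' ▸ hsk)
        exact Or.inr ⟨p, ⟨hp, hps ▸ hsk, h5 p hp⟩, hps⟩
    · rintro (h | ⟨p, ⟨hp, hpk, -⟩, rfl⟩)
      · exact ⟨h.1.1, h.2⟩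
      · exact ⟨(mem_product.1 (h1 hp)).1, hpk⟩
  have h10 : Disjoint ((unpaired T γ).filter (· < k))
      ((γ.filter fun p => p.1 < k ∧ k < p.2).image Prod.fst) := by
    rw [disjoint_left]
    intro s hs hs'
    obtain ⟨p, hp, rfl⟩ := mem_image.1 hs'
    exact ((mem_unpaired.1 (mem_filter.1 hs).1).2 p (mem_filter.1 hp).1).1 rfl
  rw [h9, card_union_of_disjoint h10, card_image_of_injOn, totalCrossingsOn, totalCrossingsOn,
    unpaired_erase, separations_eq_erase hkU, pairsOver]
  · ring
  · intro p hp r hr hpr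
    by_contra h
    exact (h3 p (mem_filter.1 hp).1 r (mem_filter.1 hr).1 h).1 hpr

end Diagrams

/-! ### The product formula in an algebra with `q`-commutation relations -/

section Product

variable {K A S ι : Type*} [CommRing K] [Ring A] [Algebra K A] [LinearOrder S]

/-- The sum over all Feynman diagrams on `T` without links inside a block, with covariances `c`. -/
noncomputable def diagramSum (q : K) (P R : S → A) (c : S → S → K) (b : S → ι) (T : Finset S) : A :=
  ∑ γ ∈ diagramsOn b T, q ^ totalCrossingsOn T γ •
    (∏ p ∈ γ, c p.1 p.2) • wickOn q P R (unpaired T γ)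

/-- The product over the blocks listed in `L` of the Wick products over the parts of `T` in these
blocks. -/
def blockProd [DecidableEq ι] (q : K) (P R : S → A) (b : S → ι) (L : List ι) (T : Finset S) : A :=
  (L.map fun p => wickOn q P R (T.filter fun s => b s = p)).prod

variable {q : K} {P R : S → A} {c : S → S → K} {b : S → ι} {T : Finset S} {m : S}

/-- Splitting off the least vertex `m` from the sum over diagrams; the correction consists of the
links of `m` inside its block. -/
theorem diagramSum_insert [PartialOrder ι] [DecidableEq ι]
    (h : ∀ i j, R i * P j = q • (P j * R i) + c i j • 1) (hb : Monotone b)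
    (hT : ∀ s ∈ T, m < s) :
    diagramSum q P R c b (insert m T) = (P m + R m) * diagramSum q P R c b T -
      ∑ k ∈ T.filter (fun k => b k = b m),
        (q ^ (T.filter (· < k)).card * c m k) • diagramSum q P R c b (T.erase k) := by
  have h1 : ∑ k ∈ T.filter (fun k => b k = b m),
      (q ^ (T.filter (· < k)).card * c m k) • diagramSum q P R c b (T.erase k) =
      ∑ γ ∈ diagramsOn b T, ∑ k ∈ (unpaired T γ).filter (fun k => b k = b m),
        (q ^ (totalCrossingsOn T γ + ((unpaired T γ).filter (· < k)).card) *
          (c m k * ∏ p ∈ γ, c p.1 p.2)) • wickOn q P R ((unpaired T γ).erase k) := by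
    rw [sum_comm' (t' := T.filter (fun k => b k = b m)) (s' := fun k => diagramsOn b (T.erase k))]
    · refine sum_congr rfl fun k hk => ?_
      rw [mem_filter] at hk
      rw [diagramSum, smul_sum]
      refine sum_congr rfl fun γ hγ => ?_
      rw [totalCrossingsOn_add_card hb hT hk.1 hk.2 hγ, unpaired_erase, smul_smul, smul_smul]
      congr 1
      ring
    · intro γ k
      rw [mem_filter, mem_filter, mem_diagramsOn_erase, mem_unpaired]
      tauto
  rw [eq_sub_iff_add_eq, h1, diagramSum, sum_diagramsOn_insert hT, ← sum_add_distrib, diagramSum,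
    mul_sum]
  refine sum_congr rfl fun γ hγ => ?_
  have h2 : ∑ k ∈ (unpaired T γ).filter (fun k => b k ≠ b m),
      q ^ totalCrossingsOn (insert m T) (insert (m, k) γ) •
        (∏ p ∈ insert (m, k) γ, c p.1 p.2) •
          wickOn q P R (unpaired (insert m T) (insert (m, k) γ)) =
      ∑ k ∈ (unpaired T γ).filter (fun k => b k ≠ b m),
        (q ^ (totalCrossingsOn T γ + ((unpaired T γ).filter (· < k)).card) *
          (c m k * ∏ p ∈ γ, c p.1 p.2)) • wickOn q P R ((unpaired T γ).erase k) := by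
    refine sum_congr rfl fun k hk => ?_
    rw [totalCrossingsOn_insert_insert hT hγ (mem_filter.1 hk).1, unpaired_insert_insert hT,
      prod_insert (notMem_of_forall_lt hT hγ k), smul_smul]
  rw [h2, add_assoc, add_comm (∑ k ∈ _ with b k ≠ b m, _), sum_filter_add_sum_filter_not,
    totalCrossingsOn_insert hT hγ, unpaired_insert hT hγ, mul_smul_comm, mul_smul_comm,
    gaussian_mul_wickOn h fun s hs => hT s (mem_unpaired.1 hs).1, smul_add, smul_add, smul_sum,
    smul_sum]
  congr 1
  refine sum_congr rfl fun k _ => ?_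
  rw [smul_smul, smul_smul, pow_add]
  congr 1
  ring

theorem blockProd_append_cons [LinearOrder ι] (hb : Monotone b) (hT : ∀ s ∈ T, m ≤ s)
    {L₁ L₂ : List ι} (hL : ∀ p ∈ L₁, p < b m) :
    blockProd q P R b (L₁ ++ b m :: L₂) T =
      wickOn q P R (T.filter fun s => b s = b m) * blockProd q P R b L₂ T := by
  have h1 : (L₁.map fun p => wickOn q P R (T.filter fun s => b s = p)).prod = 1 := by
    refine List.prod_eq_one fun x hx => ?_
    obtain ⟨p, hp, rfl⟩ := List.mem_map.1 hx
    rw [filter_false_of_mem, wickOn_empty]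
    exact fun s hs => ((hL p hp).trans_le (hb (hT s hs))).ne'
  rw [blockProd, List.map_append, List.prod_append, h1, one_mul, List.map_cons, List.prod_cons]
  rfl

theorem blockProd_congr [DecidableEq ι] {L : List ι} {U : Finset S}
    (h : ∀ s, b s ∈ L → (s ∈ T ↔ s ∈ U)) : blockProd q P R b L T = blockProd q P R b L U := by
  refine congrArg List.prod (List.map_congr_left fun p hp => ?_)
  congr 1
  ext s
  simp only [mem_filter]
  exact and_congr_left fun hs => h s (hs ▸ hp)

/-- The product of Wick products satisfies the same recursion as the sum over diagrams. -/
theorem blockProd_insert [LinearOrder ι]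
    (h : ∀ i j, R i * P j = q • (P j * R i) + c i j • 1) (hb : Monotone b)
    (hT : ∀ s ∈ T, m < s) {L : List ι} (hL : L.SortedLT) (hmL : b m ∈ L) :
    blockProd q P R b L (insert m T) = (P m + R m) * blockProd q P R b L T -
      ∑ k ∈ T.filter (fun k => b k = b m),
        (q ^ (T.filter (· < k)).card * c m k) • blockProd q P R b L (T.erase k) := by
  obtain ⟨L₁, L₂, rfl⟩ := List.append_of_mem hmL
  have hL' := List.pairwise_append.1 hL.pairwise
  have h1 : ∀ p ∈ L₁, p < b m := fun p hp => hL'.2.2 p hp _ List.mem_cons_self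
  have h2 : ∀ s, b s ∈ L₂ → b s ≠ b m := fun s hs => (List.rel_of_pairwise_cons hL'.2.1 hs).ne'
  have hle : ∀ s ∈ insert m T, m ≤ s := by
    intro s hs
    rcases mem_insert.1 hs with rfl | hs
    exacts [le_rfl, (hT s hs).le]
  rw [blockProd_append_cons hb hle h1, blockProd_append_cons hb (fun s hs => (hT s hs).le) h1,
    blockProd_congr (L := L₂) (T := insert m T) (U := T), filter_insert, if_pos rfl, ← mul_assoc,
    gaussian_mul_wickOn h fun s hs => hT s (mem_filter.1 hs).1, add_mul, eq_sub_iff_add_eq, sum_mul]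
  · congr 1
    refine sum_congr rfl fun k hk => ?_
    rw [mem_filter] at hk
    rw [blockProd_append_cons hb (fun s hs => (hT s (mem_of_mem_erase hs)).le) h1,
      blockProd_congr (L := L₂) (T := T.erase k) (U := T), smul_mul_assoc, filter_filter,
      filter_erase]
    · congr 4
      refine filter_congr fun s hs => ⟨fun hsk => ⟨?_, hsk⟩, fun h => h.2⟩
      exact le_antisymm ((hb hsk.le).trans hk.2.le) (hb (hT s hs).le)
    · intro s hs
      rw [mem_erase]
      refine and_iff_right ?_
      rintro rfl
      exact h2 _ hs hk.2
  · intro s hs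
    rw [mem_insert]
    refine or_iff_right ?_
    rintro rfl
    exact h2 _ hs rfl

/-- The product formula for Wick products in an algebra with `q`-commutation relations. -/
theorem blockProd_eq_diagramSum [LinearOrder ι]
    (h : ∀ i j, R i * P j = q • (P j * R i) + c i j • 1) (hb : Monotone b) {L : List ι}
    (hL : L.SortedLT) (hbL : ∀ s, b s ∈ L) (T : Finset S) :
    blockProd q P R b L T = diagramSum q P R c b T := by
  induction hn : T.card using Nat.strong_induction_on generalizing T with
  | _ n ih =>
    rcases T.eq_empty_or_nonempty with rfl | hne
    · rw [diagramSum, diagramsOn_empty, sum_singleton]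
      simp [blockProd, wickOn_empty, unpaired, totalCrossingsOn, crossingNumber, separations]
    · have hcard : ∀ s ∈ T, (T.erase s).card < n := fun s hs => hn ▸ card_erase_lt_of_mem hs
      obtain ⟨m, U, hU, rfl⟩ : ∃ m U, (∀ s ∈ U, m < s) ∧ T = insert m U :=
        ⟨T.min' hne, T.erase (T.min' hne), fun s hs => min'_lt_of_mem_erase_min' T hne hs,
          (insert_erase (min'_mem T hne)).symm⟩
      have hUn : U.card < n := by
        rw [← hn, card_insert_of_notMem fun h => (hU m h).false]
        exact Nat.lt_succ_self _
      rw [blockProd_insert h hb hU hL (hbL m), diagramSum_insert h hb hU, ih _ hUn U rfl]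
      congr 1
      refine sum_congr rfl fun k _ => ?_
      rw [ih _ ((card_erase_le).trans_lt hUn) _ rfl]

end Product

end QFock

namespace QFock

open scoped InnerProductSpace

/-! ### The operators on the `q`-Fock space -/

section Operators

/-- The polarized form of `AlgFock.annihilate_create`. -/
theorem AlgFock.annihilate_create_polarized {E : Type*} [NormedAddCommGroup E] [InnerProductSpace ℂ E]
    {q : Set.Ioo (-1 : ℝ) 1} (f g : E) (x : AlgFock q E) :
    annihilate q f (create q g x) =
      ((q : ℝ) : ℂ) • create q g (annihilate q f x) + ⟪f, g⟫_ℂ • x := by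
  induction x using induction with
  | h2 x y hx hy => simp only [map_add, hx, hy, smul_add]; abel
  | h1 n r k =>
    have h : annihilate q f (create q g (elem q k)) =
      ((q : ℝ) : ℂ) • create q g (annihilate q f (elem q k)) + ⟪f, g⟫_ℂ • elem q k := by
      rw [create_elem, annihilate_elem_succ, Fin.sum_univ_succ, add_comm]
      congr 1
      · cases n with
        | zero => simp [annihilate_elem_zero]
        | succ n =>
          rw [annihilate_elem_succ, map_sum, Finset.smul_sum]
          refine Finset.sum_congr rfl fun i _ => ?_
          rw [map_smul, create_elem, smul_smul]
          congr 1
          · simp [pow_succ]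
            ring
          · congr 1
            funext j
            refine Fin.cases ?_ (fun j => ?_) j <;> simp [Fin.removeNth]
      · simp
    simp only [map_smul, h, smul_add]
    rw [smul_comm r, smul_comm r ⟪f, g⟫_ℂ]

variable (q : Set.Ioo (-1 : ℝ) 1) {H₀ : Type*} [NormedAddCommGroup H₀] [InnerProductSpace ℝ H₀]

theorem creation_coe (f : H₀) (x : AlgFock q (Complexification H₀)) :
    creation q f (x : Fock q H₀) =
      (AlgFock.create q (Complexification.ofReal f) x : AlgFock q (Complexification H₀)) :=
  UniformSpace.Completion.map_coe (AlgFock.createCLM q (Complexification.ofReal f)).uniformContinuous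
    x

theorem annihilation_coe (f : H₀) (x : AlgFock q (Complexification H₀)) :
    annihilation q f (x : Fock q H₀) =
      (AlgFock.annihilate q (Complexification.ofReal f) x : AlgFock q (Complexification H₀)) :=
  UniformSpace.Completion.map_coe
    (AlgFock.annihilateCLM q (Complexification.ofReal f)).uniformContinuous x

/-- The `q`-commutation relation `a⁻(f) a⁺(g) = q a⁺(g) a⁻(f) + ⟨f, g⟩`. -/
theorem annihilation_mul_creation (f g : H₀) :
    annihilation q f * creation q g =
      ((q : ℝ) : ℂ) • (creation q g * annihilation q f) + ((⟪f, g⟫_ℝ : ℝ) : ℂ) • 1 := by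
  ext x
  induction x using UniformSpace.Completion.induction_on with
  | hp => exact isClosed_eq (ContinuousLinearMap.continuous _) (ContinuousLinearMap.continuous _)
  | ih x =>
    change annihilation q f (creation q g x) = ((q : ℝ) : ℂ) • creation q g (annihilation q f x) +
      ((⟪f, g⟫_ℝ : ℝ) : ℂ) • (x : Fock q H₀)
    rw [creation_coe, annihilation_coe, annihilation_coe, creation_coe,
      AlgFock.annihilate_create_polarized, Complexification.inner_ofReal]
    push_cast
    rfl

theorem annihilation_vacuum (f : H₀) : annihilation q f (vacuum q) = 0 := by
  rw [vacuum, annihilation_coe, AlgFock.annihilate_elem_zero]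
  rfl

theorem inner_vacuum_vacuum : ⟪(vacuum q : Fock q H₀), vacuum q⟫_ℂ = 1 := by
  rw [vacuum, UniformSpace.Completion.inner_coe, AlgFock.inner_def, AlgFock.form_elem_elem]
  simp [inversions]

theorem inner_vacuum_creation_creation (f g : H₀) :
    ⟪(vacuum q : Fock q H₀), creation q f (creation q g (vacuum q))⟫_ℂ = 0 := by
  rw [vacuum, creation_coe, creation_coe, UniformSpace.Completion.inner_coe, AlgFock.inner_def,
    AlgFock.create_elem, AlgFock.create_elem, AlgFock.form_elem_elem_of_ne (by decide)]

theorem vacuumState_gaussian_mul_gaussian (f g : H₀) :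
    vacuumState q (gaussian q f * gaussian q g) = ((⟪f, g⟫_ℝ : ℝ) : ℂ) := by
  have h1 : gaussian q g (vacuum q) = creation q g (vacuum q) := by
    change creation q g _ + annihilation q g _ = _
    rw [annihilation_vacuum, add_zero]
  have h2 : annihilation q f (creation q g (vacuum q)) =
      ((⟪f, g⟫_ℝ : ℝ) : ℂ) • (vacuum q : Fock q H₀) := by
    have h := DFunLike.congr_fun (annihilation_mul_creation q f g) (vacuum q)
    change annihilation q f (creation q g (vacuum q)) =
      ((q : ℝ) : ℂ) • creation q g (annihilation q f (vacuum q)) +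
      ((⟪f, g⟫_ℝ : ℝ) : ℂ) • vacuum q at h
    rwa [annihilation_vacuum, map_zero, smul_zero, zero_add] at h
  change ⟪vacuum q, gaussian q f (gaussian q g (vacuum q))⟫_ℂ = _
  rw [h1]
  change ⟪vacuum q, creation q f (creation q g (vacuum q)) +
    annihilation q f (creation q g (vacuum q))⟫_ℂ = _
  rw [h2, inner_add_right, inner_vacuum_creation_creation, inner_smul_right, inner_vacuum_vacuum,
    zero_add, mul_one]

end Operators

/-! ### Wick products and diagrams on an ordered index set -/

section Transfer

variable {S : Type*} [LinearOrder S]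

theorem ordProd_map {A : Type*} [Ring A] {n : ℕ} (e : Fin n ↪o S) (P : S → A) (I : Finset (Fin n)) :
    ordProd P (I.map e.toEmbedding) = ((I.sort (· ≤ ·)).map fun i => P (e i)).prod := by
  rw [ordProd, ← Finset.map_sort (s := I) (r := (· ≤ ·)) (r' := (· ≤ ·)) e.toEmbedding, List.map_map]
  · rfl
  · intro a _ b _
    exact e.le_iff_le.symm

theorem invs_map {n : ℕ} (e : Fin n ↪o S) (I J : Finset (Fin n)) :
    invs (I.map e.toEmbedding) (J.map e.toEmbedding) =
      ((I ×ˢ J).filter fun p => p.2 < p.1).card := by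
  simp only [invs, Finset.card_filter, Finset.sum_product, Finset.sum_map,
    RelEmbedding.coe_toEmbedding, e.lt_iff_lt]

variable (q : Set.Ioo (-1 : ℝ) 1) {H₀ : Type*} [NormedAddCommGroup H₀] [InnerProductSpace ℝ H₀]

theorem wick_comp_orderEmbedding {n : ℕ} (e : Fin n ↪o S) (f : S → H₀) :
    wick q (fun k => f (e k)) = wickOn ((q : ℝ) : ℂ) (fun s => creation q (f s))
      (fun s => annihilation q (f s)) (Finset.univ.map e.toEmbedding) := by
  rw [wick, wickOn]
  refine Finset.sum_bij (fun I _ => I.map e.toEmbedding) ?_ ?_ ?_ ?_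
  · intro I _
    exact Finset.mem_powerset.2 (Finset.map_subset_map.2 (Finset.subset_univ I))
  · intro I _ J _ h
    exact Finset.map_injective _ h
  · intro I hI
    obtain ⟨J, -, rfl⟩ := Finset.subset_map_iff.1 (Finset.mem_powerset.1 hI)
    exact ⟨J, Finset.mem_univ _, rfl⟩
  · intro I _
    rw [← Finset.map_sdiff, ← Finset.compl_eq_univ_sdiff, ordProd_map, ordProd_map, invs_map]

theorem unpaired_univ [Fintype S] (γ : Finset (S × S)) :
    unpaired Finset.univ γ = singletons γ := by
  ext k
  simp [mem_unpaired, singletons]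

theorem totalCrossingsOn_univ [Fintype S] (γ : Finset (S × S)) :
    totalCrossingsOn Finset.univ γ = totalCrossingNumber γ := by
  rw [totalCrossingsOn, totalCrossingNumber, unpaired_univ, degenerateCrossings, Finset.card_filter,
    Finset.sum_product_right]
  congr 1
  exact Finset.sum_congr rfl fun k _ => Finset.card_filter _ _

theorem wickDiagram_eq [Fintype S] (f : S → H₀) (γ : Finset (S × S)) :
    wickDiagram q f γ = (∏ p ∈ γ, ((⟪f p.1, f p.2⟫_ℝ : ℝ) : ℂ)) •
      wickOn ((q : ℝ) : ℂ) (fun s => creation q (f s)) (fun s => annihilation q (f s))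
        (unpaired Finset.univ γ) := by
  simp only [wickDiagram, vacuumState_gaussian_mul_gaussian]
  rw [wick_comp_orderEmbedding q ((singletons γ).orderEmbOfFin rfl) f,
    Finset.map_orderEmbOfFin_univ, unpaired_univ]

/-- The inclusion of a block in a lexicographic sum. -/
def blockEmb {t : ℕ} (n : Fin t → ℕ) (p : Fin t) : Fin (n p) ↪o Σₗ p : Fin t, Fin (n p) :=
  OrderEmbedding.ofMapLEIff (fun k => toLex ⟨p, k⟩) fun k l => by
    rw [Sigma.Lex.le_def]
    exact ⟨fun h => h.elim (fun h => absurd h (lt_irrefl p)) fun h => h.2,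
      fun h => Or.inr ⟨rfl, h⟩⟩

theorem map_blockEmb {t : ℕ} (n : Fin t → ℕ) (p : Fin t) :
    Finset.univ.map (blockEmb n p).toEmbedding =
      Finset.univ.filter fun s : Σₗ p : Fin t, Fin (n p) => (ofLex s).1 = p := by
  ext s
  simp only [Finset.mem_map, Finset.mem_univ, true_and, Finset.mem_filter]
  constructor
  · rintro ⟨k, rfl⟩
    rfl
  · rintro rfl
    exact ⟨(ofLex s).2, rfl⟩

theorem monotone_block {t : ℕ} (n : Fin t → ℕ) :
    Monotone fun s : Σₗ p : Fin t, Fin (n p) => (ofLex s).1 := by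
  intro s s' h
  rcases Sigma.Lex.le_def.1 h with h | ⟨h, -⟩
  exacts [le_of_lt h, le_of_eq h]

theorem blockDiagrams_eq {t : ℕ} (n : Fin t → ℕ) :
    blockDiagrams n = diagramsOn (fun s => (ofLex s).1) Finset.univ := by
  ext γ
  simp only [blockDiagrams, Finset.mem_filter, Finset.mem_univ, true_and, mem_diagramsOn]
  exact (and_iff_right fun _ _ => by simp).symm

end Transfer

end QFock

theorem mainTheorem5 {H₀ : Type*} [NormedAddCommGroup H₀] [InnerProductSpace ℝ H₀]
    [CompleteSpace H₀] (q : Set.Ioo (-1 : ℝ) 1) (t : ℕ) (n : Fin t → ℕ)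
    (f : (p : Fin t) → Fin (n p) → H₀) :
    (List.ofFn fun p => QFock.wick q (f p)).prod =
      ∑ γ ∈ QFock.blockDiagrams n, (((q : ℝ) : ℂ) ^ QFock.totalCrossingNumber γ) •
        QFock.wickDiagram q (fun s => f (ofLex s).1 (ofLex s).2) γ := by
  have key := QFock.blockProd_eq_diagramSum
    (fun s s' : Σₗ p : Fin t, Fin (n p) =>
      QFock.annihilation_mul_creation q (f (ofLex s).1 (ofLex s).2) (f (ofLex s').1 (ofLex s').2))
    (QFock.monotone_block n) (List.sortedLT_finRange t) (fun s => List.mem_finRange _) Finset.univ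
  rw [QFock.blockDiagrams_eq, List.ofFn_eq_map]
  refine Eq.trans ?_ (key.trans ?_)
  · refine congrArg List.prod (List.map_congr_left fun p _ => ?_)
    rw [← QFock.map_blockEmb, ← QFock.wick_comp_orderEmbedding q (QFock.blockEmb n p)
      fun s => f (ofLex s).1 (ofLex s).2]
    rfl
  · refine Finset.sum_congr rfl fun γ _ => ?_
    rw [QFock.totalCrossingsOn_univ, QFock.wickDiagram_eq]
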